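/- Let SAT be the satisfiability problem for Boolean formulas in conjunctive normal form, encoded as a language $\mathrm{SAT}\subseteq\{0,1\}^*$ (a word that encodes no formula is a no-instance). **Discovery Vertex Cover Reconfiguration.** An instance consists of a finite vertex set $V=\{0,\dots,n-1\}$, a word $I_{u,v}\in\{0,1\}^*$ for each pair $u<v$ in $V$, two sets $S,T\subseteq V$, and two integers $k,\ell\ge 0$. The *discovered graph* $G=(V,E)$ has $\{u,v\}\in E$ if and only if $I_{u,v}\in\mathrm{SAT}$, for $u<v$. It is required that $S$ and $T$ are inclusion-minimal vertex covers of $G$. The question is whether $\ell\ge 1$ and there are vertex covers $X_1,\dots,X_\ell$ of $G$, each of size at most $k$, such that $X_1=S$, $X_\ell=T$, and $|X_i\triangle X_{i+1}|\le 1$ for all $1\le i<\ell$. The problem is parameterized by $k$: it is the set $L\subseteq\{0,1\}^*\times\mathbb N$ of all pairs $(x,k)$ such that $x$ encodes $V$, the words $I_{u,v}$, $S$, $T$ and $\ell$ (with $\ell$ in binary), $S$ and $T$ are minimal vertex covers of $G$, and the answer is yes. **Polynomial $\mathsf P^{\mathsf{NP}}$-kernel.** A decidable parameterized problem $L\subseteq\{0,1\}^*\times\mathbb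 N$ admits a polynomial $\mathsf P^{\mathsf{NP}}$-kernel if there are a polynomial $q$ and an algorithm with oracle access to the $\mathsf{NP}$-complete problem SAT, where a query takes one step, that transforms every $(x,r)\in\{0,1\}^*\times\mathbb N$, in time polynomial in $|x|+r$, into a pair $(x',r')\in\{0,1\}^*\times\mathbb N$ such that $|x'|+r'\le q(r)$, and $(x',r')\in L$ if and only if $(x,r)\in L$. **Theorem.** Discovery Vertex Cover Reconfiguration, parameterized by $k$, is decidable and admits a polynomial $\mathsf P^{\mathsf{NP}}$-kernel. -/

import Mathlib

namespace OracleKernel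

/-- Words over the binary alphabet. -/
abbrev Word := List Bool

/-- A parameterized problem: a set of pairs of a word and a parameter. -/
abbrev ParamProblem := Set (Word × ℕ)

/-! ### Oracle machines

The machine model is a multi-stack machine with structured control and an oracle. A program uses
finitely many registers, each holding a word that is only accessible at its top (its head). Every
elementary instruction touches a single top symbol and costs one step, so running times agree with
those of multi-tape oracle Turing machines up to a polynomial. -/

/-- Oracle programs. -/
inductive Program : Type
  /-- do nothing -/
  | skip : Program
  /-- push the symbol `b` onto register `r` -/
  | push (r : ℕ) (b : Bool) : Program
  /-- remove the top symbol of register `r`, if there is one -/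
  | pop (r : ℕ) : Program
  /-- replace the content `w` of register `r` by the one-symbol answer to the query `w ∈ O` -/
  | query (r : ℕ) : Program
  /-- run two programs one after the other -/
  | seq (c d : Program) : Program
  /-- run `cEmpty`, `cFalse` or `cTrue` according as register `r` is empty, has top symbol `false`
  or has top symbol `true` -/
  | branch (r : ℕ) (cEmpty cFalse cTrue : Program) : Program
  /-- run `c` again and again as long as register `r` is non-empty -/
  | loop (r : ℕ) (c : Program) : Program

/-- A memory state: the contents of all registers. -/
abbrev State := ℕ → Word

/-- `Exec O c s s' t`: with oracle `O`, the program `c` started in state `s` halts in state `s'`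
after exactly `t` steps. An oracle call is a single step. -/
inductive Exec (O : Set Word) : Program → State → State → ℕ → Prop
  | skip (s : State) : Exec O Program.skip s s 1
  | push (r : ℕ) (b : Bool) (s : State) :
      Exec O (Program.push r b) s (Function.update s r (b :: s r)) 1
  | pop (r : ℕ) (s : State) :
      Exec O (Program.pop r) s (Function.update s r (s r).tail) 1
  | queryYes (r : ℕ) (s : State) (h : s r ∈ O) :
      Exec O (Program.query r) s (Function.update s r [true]) 1
  | queryNo (r : ℕ) (s : State) (h : s r ∉ O) :
      Exec O (Program.query r) s (Function.update s r [false]) 1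
  | seq {c d : Program} {s s' s'' : State} {t t' : ℕ}
      (h : Exec O c s s' t) (h' : Exec O d s' s'' t') :
      Exec O (Program.seq c d) s s'' (t + t')
  | branchEmpty {r : ℕ} {c₀ c₁ c₂ : Program} {s s' : State} {t : ℕ}
      (hr : s r = []) (h : Exec O c₀ s s' t) :
      Exec O (Program.branch r c₀ c₁ c₂) s s' (t + 1)
  | branchFalse {r : ℕ} {c₀ c₁ c₂ : Program} {s s' : State} {t : ℕ}
      (hr : (s r).head? = some false) (h : Exec O c₁ s s' t) :
      Exec O (Program.branch r c₀ c₁ c₂) s s' (t + 1)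
  | branchTrue {r : ℕ} {c₀ c₁ c₂ : Program} {s s' : State} {t : ℕ}
      (hr : (s r).head? = some true) (h : Exec O c₂ s s' t) :
      Exec O (Program.branch r c₀ c₁ c₂) s s' (t + 1)
  | loopDone {r : ℕ} {c : Program} {s : State} (hr : s r = []) :
      Exec O (Program.loop r c) s s 1
  | loopStep {r : ℕ} {c : Program} {s s' s'' : State} {t t' : ℕ}
      (hr : s r ≠ []) (h : Exec O c s s' t) (h' : Exec O (Program.loop r c) s' s'' t') :
      Exec O (Program.loop r c) s s'' (t + t' + 1)

/-- The state that holds the pair `(x, r)`: the word `x` in register `0`, the number `r` in unary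
in register `1`, and all other registers empty. -/
def inputState (z : Word × ℕ) : State :=
  fun i => if i = 0 then z.1 else if i = 1 then List.replicate z.2 true else []

/-- `f` is computed by an algorithm with oracle `O` in time polynomial in `|x| + r`. The output
pair is read off from registers `0` and `1`, in the format of the input. -/
def PolyTimeComputable (O : Set Word) (f : Word × ℕ → Word × ℕ) : Prop :=
  ∃ (c : Program) (p : Polynomial ℕ), ∀ (x : Word) (r : ℕ), ∃ (s : State) (t : ℕ),
    Exec O c (inputState (x, r)) s t ∧ t ≤ p.eval (x.length + r) ∧
      s 0 = (f (x, r)).1 ∧ s 1 = List.replicate (f (x, r)).2 true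

/-! ### Satisfiability -/

/-- A literal: a sign (`true` for an unnegated, `false` for a negated variable) and the variable,
where the variables are indexed by words. -/
abbrev Literal := Bool × Word

/-- A Boolean formula in conjunctive normal form, as a list of clauses. -/
abbrev CNF := List (List Literal)

/-- Some truth assignment makes at least one literal of every clause true. -/
def Satisfiable (φ : CNF) : Prop :=
  ∃ α : Word → Bool, ∀ c ∈ φ, ∃ l ∈ c, α l.2 = l.1

/-- Two-bit blocks: `0b` stands for the symbol `b`, `10` ends a literal, and `11` ends a clause. -/
def encodeLiteral (l : Literal) : Word :=
  (l.1 :: l.2).flatMap (fun b => [false, b]) ++ [true, false]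

def encodeClause (c : List Literal) : Word :=
  c.flatMap encodeLiteral ++ [true, true]

def encodeCNF (φ : CNF) : Word :=
  φ.flatMap encodeClause

/-- The language SATISFIABILITY: all words that encode a satisfiable formula. -/
def SAT : Set Word :=
  {w | ∃ φ : CNF, encodeCNF φ = w ∧ Satisfiable φ}

/-! ### Polynomial kernels with an NP-oracle -/

/-- A decidable parameterized problem admits a polynomial kernel relative to the oracle `O` if an
algorithm with oracle `O` maps, in polynomial time, every `(x, r)` to an equivalent `(x', r')` such
that `|x'| + r'` is at most a polynomial in `r`. -/
def HasPolyKernel (O : Set Word) (L : ParamProblem) : Prop :=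
  ComputablePred (fun z : Word × ℕ => z ∈ L) ∧
    ∃ f : Word × ℕ → Word × ℕ,
      PolyTimeComputable O f ∧
      (∃ q : Polynomial ℕ, ∀ (x : Word) (r : ℕ),
        (f (x, r)).1.length + (f (x, r)).2 ≤ q.eval r) ∧
      ∀ z : Word × ℕ, f z ∈ L ↔ z ∈ L

/-- Polynomial P^NP-kernels: the NP-complete oracle is SATISFIABILITY. -/
def HasPolyPNPKernel (L : ParamProblem) : Prop :=
  HasPolyKernel SAT L

/-! ### Discovery Vertex Cover Reconfiguration -/

/-- The data of an instance, apart from the size bound `k`: the vertex set is `Fin n`, and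
`I v u` is the instance of SATISFIABILITY for the pair of the vertices `u < v`. -/
structure Instance where
  n : ℕ
  I : (v : Fin n) → Fin v → Word
  S : Finset (Fin n)
  T : Finset (Fin n)
  len : ℕ

namespace Instance

/-- The discovered graph: two distinct vertices are adjacent if and only if the instance of
SATISFIABILITY for the pair is a yes-instance. -/
def graph (A : Instance) : SimpleGraph (Fin A.n) :=
  SimpleGraph.fromRel (fun u v => ∃ h : u < v, A.I v ⟨u, h⟩ ∈ SAT)

/-- `C` is a vertex cover of the discovered graph. -/
def IsCover (A : Instance) (C : Finset (Fin A.n)) : Prop :=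
  A.graph.IsVertexCover (C : Set (Fin A.n))

/-- The sets `S` and `T` are (inclusion-)minimal vertex covers of the discovered graph. -/
def IsProper (A : Instance) : Prop :=
  Minimal A.IsCover A.S ∧ Minimal A.IsCover A.T

/-- There is a sequence `X 1, …, X len` of vertex covers of size at most `k` from `S` to `T` in
which consecutive sets differ in at most one vertex. -/
def Reconfigurable (A : Instance) (k : ℕ) : Prop :=
  1 ≤ A.len ∧ ∃ X : ℕ → Finset (Fin A.n),
    X 1 = A.S ∧ X A.len = A.T ∧
    (∀ i, 1 ≤ i → i ≤ A.len → A.IsCover (X i) ∧ (X i).card ≤ k) ∧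
    ∀ i, 1 ≤ i → i < A.len → (symmDiff (X i) (X (i + 1))).card ≤ 1

/-- Self-delimiting encoding of a word: every symbol `b` becomes `1b`, and `0` ends the word. -/
def field (w : Word) : Word :=
  w.flatMap (fun b => [true, b]) ++ [false]

/-- The characteristic vector of a set of vertices. -/
def charVector {n : ℕ} (C : Finset (Fin n)) : Word :=
  (List.finRange n).map (fun v => decide (v ∈ C))

/-- The encoding of an instance: the length `len` in binary, the characteristic vectors of `S` and
`T` (whose lengths give `n`), and the instances of SATISFIABILITY for all pairs of vertices. -/
def encode (A : Instance) : Word :=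
  field (Nat.bits A.len) ++ field (charVector A.S) ++ field (charVector A.T) ++
    (List.finRange A.n).flatMap (fun v : Fin A.n => (List.finRange v.val).flatMap (fun u => field (A.I v u)))

end Instance

/-- DISCOVERY VERTEX COVER RECONFIGURATION, parameterized by the size bound `k`. -/
def DiscoveryVertexCoverReconfiguration : ParamProblem :=
  {z | ∃ A : Instance, A.encode = z.1 ∧ A.IsProper ∧ A.Reconfigurable z.2}

end OracleKernel

/-! In a yes-instance `S` and `T` have at most `k` elements; everything that fails this test, or is
not a proper instance, is mapped to the empty word, which encodes no instance. Otherwise the SAT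
oracle makes the discovered graph explicit.

Keep `S ∪ T` and, for each of its vertices, the first `k + 1` neighbours; these are at most `2k +
2k(k + 1)` vertices (`countP_keep_le`). An edge with a dropped endpoint has its other endpoint `v`
in `S`, because `S` is a cover and is kept. A vertex of `S ∪ T` that loses a neighbour retains more
than `k` neighbours (`exists_kept_neighbours`), so every cover of the kept graph of size at most `k`
contains it. Hence such covers also cover the lost edges (`IsRestriction.isCover_map`). Conversely,
covers restrict to the kept vertices, and so whole sequences transfer both ways
(`IsRestriction.reconfigurable_iff`). The same count shows that `S` and `T` stay minimal
(`IsRestriction.minimal`).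

Two parts of the input can still be long. The words of the pairs are replaced by constant yes- and
no-instances of SAT. The sequence length is capped: a path in the graph of covers visits each of the
at most `2 ^ m` subsets of `m` vertices once and can be padded by repetition, so all lengths from `2
^ m` on are equivalent (`reconfigurable_congr_len`).

Polynomial running time comes from a compositional predicate `PT`, closed under branching, oracle
calls and loops with polynomially bounded accumulators (`PT.loop`). Decidability is shown
separately, by primitive recursion: brute force for satisfiability and step-by-step enumeration of
the reachable covers. -/

namespace OracleKernel

/-! ### Running times -/

/-- The program `c` leads from `s` to `s'` within `b` steps. -/
def Runs (O : Set Word) (c : Program) (s s' : State) (b : ℕ) : Prop :=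
  ∃ t ≤ b, Exec O c s s' t

section Runs

variable {O : Set Word}

theorem Runs.mono {c : Program} {s s' : State} {a b : ℕ} (h : Runs O c s s' a) (hab : a ≤ b) :
    Runs O c s s' b := by
  obtain ⟨t, ht, h⟩ := h
  exact ⟨t, ht.trans hab, h⟩

theorem Runs.of_eq {c : Program} {s s' s'' : State} {a b : ℕ} (h : Runs O c s s' a)
    (hs : s' = s'') (hab : a ≤ b) : Runs O c s s'' b :=
  hs ▸ h.mono hab

theorem Runs.seq {c d : Program} {s s' s'' : State} {a b : ℕ} (h : Runs O c s s' a)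
    (h' : Runs O d s' s'' b) : Runs O (c.seq d) s s'' (a + b) := by
  obtain ⟨t, ht, h⟩ := h
  obtain ⟨t', ht', h'⟩ := h'
  exact ⟨t + t', Nat.add_le_add ht ht', h.seq h'⟩

theorem Runs.push (r : ℕ) (b : Bool) (s : State) :
    Runs O (.push r b) s (Function.update s r (b :: s r)) 1 :=
  ⟨1, le_rfl, .push r b s⟩

theorem Runs.pop (r : ℕ) (s : State) :
    Runs O (.pop r) s (Function.update s r (s r).tail) 1 :=
  ⟨1, le_rfl, .pop r s⟩

theorem Runs.branch {r : ℕ} {c₀ c₁ c₂ : Program} {s s' : State} {b : ℕ}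
    (h₀ : s r = [] → Runs O c₀ s s' b)
    (h₁ : (s r).head? = some false → Runs O c₁ s s' b)
    (h₂ : (s r).head? = some true → Runs O c₂ s s' b) :
    Runs O (.branch r c₀ c₁ c₂) s s' (b + 1) := by
  rcases h : s r with _ | ⟨_ | _, w⟩
  · obtain ⟨t, ht, h'⟩ := h₀ h
    exact ⟨t + 1, by omega, .branchEmpty h h'⟩
  · obtain ⟨t, ht, h'⟩ := h₁ (by simp [h])
    exact ⟨t + 1, by omega, .branchFalse (by simp [h]) h'⟩
  · obtain ⟨t, ht, h'⟩ := h₂ (by simp [h])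
    exact ⟨t + 1, by omega, .branchTrue (by simp [h]) h'⟩

/-- Each of the `N` rounds costs the body and one test; the last `+ 1` is the test that ends the
loop. Naming the states `σ i` in advance spares later loops an induction over executions. -/
theorem Runs.loop {r : ℕ} {c : Program} {b : ℕ} (N : ℕ) (σ : ℕ → State)
    (hne : ∀ i < N, σ i r ≠ []) (hN : σ N r = [])
    (h : ∀ i < N, Runs O c (σ i) (σ (i + 1)) b) :
    Runs O (.loop r c) (σ 0) (σ N) (N * (b + 1) + 1) := by
  induction N generalizing σ with
  | zero => exact ⟨1, by omega, .loopDone hN⟩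
  | succ N ih =>
    obtain ⟨t', ht', h'⟩ := ih (fun i => σ (i + 1)) (fun i hi => hne _ (by omega)) hN
      (fun i hi => h _ (by omega))
    obtain ⟨t, ht, h0⟩ := h 0 (by omega)
    refine ⟨t + t' + 1, ?_, .loopStep (hne 0 (by omega)) h0 h'⟩
    rw [Nat.add_mul]
    omega

/-- Empty register `r`. -/
def clearReg (r : ℕ) : Program := .loop r (.pop r)

theorem runs_clearReg (r : ℕ) (s : State) :
    Runs O (clearReg r) s (Function.update s r []) (2 * (s r).length + 1) := by
  have := Runs.loop (O := O) (r := r) (c := .pop r) (b := 1) (s r).length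
    (fun i => Function.update s r ((s r).drop i)) (fun i hi => by simpa using hi) (by simp)
    (fun i hi => by
      have := Runs.pop (O := O) r (Function.update s r ((s r).drop i))
      simpa using this)
  simp only [List.drop_zero, Function.update_eq_self, List.drop_length] at this
  exact this.mono (by omega)

/-- Pour the content of register `r` onto register `a`, in reversed order. -/
def pourReg (r a : ℕ) : Program :=
  .loop r (.seq (.branch r .skip (.push a false) (.push a true)) (.pop r))

theorem runs_pourReg {r a : ℕ} (hra : r ≠ a) (w : Word) (s : State) (hw : s r = w) :
    Runs O (pourReg r a) s
      (Function.update (Function.update s r []) a (w.reverse ++ s a)) (4 * w.length + 1) := by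
  induction w generalizing s with
  | nil =>
    refine ⟨1, by omega, ?_⟩
    have h : Function.update s r [] = s := by rw [← hw, Function.update_eq_self]
    have : Function.update (Function.update s r []) a ([].reverse ++ s a) = s := by
      simp [h]
    rw [this]
    exact .loopDone hw
  | cons b w ih =>
    have hstep : Exec O (.seq (.branch r .skip (.push a false) (.push a true)) (.pop r)) s
        (Function.update (Function.update s a (b :: s a)) r w) 3 := by
      have hpop := Exec.pop (O := O) r (Function.update s a (b :: s a))
      simp only [Function.update_of_ne hra, hw, List.tail_cons] at hpop
      refine Exec.seq (t := 2) ?_ hpop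
      cases b
      · exact .branchFalse (by simp [hw]) (.push a false s)
      · exact .branchTrue (by simp [hw]) (.push a true s)
    obtain ⟨t, ht, h⟩ := ih (Function.update (Function.update s a (b :: s a)) r w) (by simp)
    refine Runs.of_eq ⟨3 + t + 1, le_rfl, Exec.loopStep (by simp [hw]) hstep h⟩ ?_
      (by simp; omega)
    funext i
    simp only [Function.update_apply]
    split_ifs <;> simp_all

/-- Pour the content of register `r` onto the registers `a` and `b`, in reversed order. -/
def pourReg₂ (r a b : ℕ) : Program :=
  .loop r (.seq (.branch r .skip (.seq (.push a false) (.push b false))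
    (.seq (.push a true) (.push b true))) (.pop r))

theorem runs_pourReg₂ {r a b : ℕ} (hra : r ≠ a) (hrb : r ≠ b) (hab : a ≠ b) (w : Word) (s : State)
    (hw : s r = w) :
    Runs O (pourReg₂ r a b) s (Function.update (Function.update (Function.update s r [])
      a (w.reverse ++ s a)) b (w.reverse ++ s b)) (5 * w.length + 1) := by
  induction w generalizing s with
  | nil =>
    refine ⟨1, by omega, ?_⟩
    have h : Function.update s r [] = s := by rw [← hw, Function.update_eq_self]
    have : Function.update (Function.update (Function.update s r []) a ([].reverse ++ s a)) b
        ([].reverse ++ s b) = s := by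
      simp [h]
    rw [this]
    exact .loopDone hw
  | cons x w ih =>
    have hstep : Exec O (.seq (.branch r .skip (.seq (.push a false) (.push b false))
        (.seq (.push a true) (.push b true))) (.pop r)) s
        (Function.update (Function.update (Function.update s a (x :: s a)) b (x :: s b)) r w) 4 := by
      have hpop := Exec.pop (O := O) r
        (Function.update (Function.update s a (x :: s a)) b (x :: s b))
      simp only [Function.update_of_ne hra, Function.update_of_ne hrb, hw, List.tail_cons] at hpop
      refine Exec.seq (t := 3) ?_ hpop
      have hpush (y : Bool) : Exec O (.seq (.push a y) (.push b y)) s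
          (Function.update (Function.update s a (y :: s a)) b (y :: s b)) 2 := by
        have h2 := Exec.push (O := O) b y (Function.update s a (y :: s a))
        simp only [Function.update_of_ne hab.symm] at h2
        exact .seq (.push a y s) h2
      cases x
      · exact .branchFalse (by simp [hw]) (hpush false)
      · exact .branchTrue (by simp [hw]) (hpush true)
    obtain ⟨t, ht, h⟩ := ih
      (Function.update (Function.update (Function.update s a (x :: s a)) b (x :: s b)) r w) (by simp)
    refine Runs.of_eq ⟨4 + t + 1, le_rfl, Exec.loopStep (by simp [hw]) hstep h⟩ ?_
      (by simp; omega)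
    funext i
    simp only [Function.update_apply]
    split_ifs <;> simp_all

/-- Copy register `r` into the empty register `m`, with the empty register `m + 1` as workspace. -/
def copyReg (r m : ℕ) : Program := .seq (pourReg r (m + 1)) (pourReg₂ (m + 1) r m)

theorem runs_copyReg {r m : ℕ} (hr : r < m) (s : State) (h₀ : s m = []) (h₁ : s (m + 1) = []) :
    Runs O (copyReg r m) s (Function.update s m (s r)) (9 * (s r).length + 2) := by
  have h := runs_pourReg (O := O) (r := r) (a := m + 1) (by omega) (s r) s rfl
  rw [h₁, List.append_nil] at h
  have h' := runs_pourReg₂ (O := O) (r := m + 1) (a := r) (b := m) (by omega) (by omega) (by omega)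
    (s r).reverse (Function.update (Function.update s r []) (m + 1) (s r).reverse) (by simp)
  refine (h.seq h').of_eq ?_ (by simp; omega)
  funext i
  simp only [Function.update_apply, List.reverse_reverse]
  split_ifs <;> first | omega | simp_all

/-- Move the content of register `r` to the empty register `a`, with the empty register `x` as
workspace. -/
def moveReg (r x a : ℕ) : Program := .seq (pourReg r x) (pourReg x a)

theorem runs_moveReg {r x a : ℕ} (hrx : r ≠ x) (hra : r ≠ a) (hxa : x ≠ a) (s : State)
    (hx : s x = []) (ha : s a = []) :
    Runs O (moveReg r x a) s (Function.update (Function.update s r []) a (s r))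
      (8 * (s r).length + 2) := by
  have h := runs_pourReg (O := O) hrx (s r) s rfl
  rw [hx, List.append_nil] at h
  have h' := runs_pourReg (O := O) hxa
    (s r).reverse (Function.update (Function.update s r []) x (s r).reverse) (by simp)
  refine (h.seq h').of_eq ?_ (by simp; omega)
  funext i
  simp only [Function.update_apply, List.reverse_reverse]
  split_ifs <;> simp_all

end Runs

/-! ### Functions that are computable in polynomial time from known values

For a set `V` of functions on a type `Γ`, whose values are available in registers, `PT O V f` states
that the value of `f` can be computed from them in polynomial time. -/

/-- The register allocation `ρ` and the first free register `m` are arbitrary, so programs can be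
nested without renaming. A program must leave every register except `m` as it found it. Sizes and
times are measured in one common bound `B` on the known values, and output sizes are bounded as
well, which makes composition polynomial. -/
structure PT (O : Set Word) {Γ : Type} (V : Set (Γ → Word)) (f : Γ → Word) : Prop where
  bound : ∃ q : Polynomial ℕ, ∀ γ B, (∀ v ∈ V, (v γ).length ≤ B) → (f γ).length ≤ q.eval B
  run : ∀ (ρ : (Γ → Word) → ℕ) (m : ℕ), (∀ v ∈ V, ρ v < m) →
    ∃ (c : Program) (p : Polynomial ℕ), ∀ γ s B, (∀ v ∈ V, s (ρ v) = v γ) →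
      (∀ v ∈ V, (v γ).length ≤ B) → (∀ j, m ≤ j → s j = []) →
        Runs O c s (Function.update s m (f γ)) (p.eval B)

/-- Case distinction according to the top symbol of a word. -/
def select (w a b c : Word) : Word :=
  match w with
  | [] => a
  | false :: _ => b
  | true :: _ => c

/-- The unary counter of a loop. -/
def idx (Γ : Type) : Γ × ℕ → Word := fun z => List.replicate z.2 true

/-- The functions of `V` as functions of the current value and the loop counter. -/
def lift {Γ : Type} (V : Set (Γ → Word)) : Set (Γ × ℕ → Word) :=
  insert (idx Γ) ((fun v z => v z.1) '' V)

namespace PT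

variable {O : Set Word} {Γ : Type} {V W : Set (Γ → Word)} {f g h : Γ → Word}

theorem mono (hf : PT O V f) (hVW : V ⊆ W) : PT O W f := by
  refine ⟨?_, fun ρ m hρ => ?_⟩
  · obtain ⟨q, hq⟩ := hf.bound
    exact ⟨q, fun γ B hB => hq γ B fun v hv => hB v (hVW hv)⟩
  · obtain ⟨c, p, hc⟩ := hf.run ρ m fun v hv => hρ v (hVW hv)
    exact ⟨c, p, fun γ s B h₁ h₂ h₃ =>
      hc γ s B (fun v hv => h₁ v (hVW hv)) (fun v hv => h₂ v (hVW hv)) h₃⟩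

theorem var (hf : f ∈ V) : PT O V f := by
  refine ⟨⟨.X, fun γ B hB => by simpa using hB f hf⟩, fun ρ m hρ => ?_⟩
  refine ⟨copyReg (ρ f) m, 9 * .X + 2, fun γ s B h₁ h₂ h₃ => ?_⟩
  have := runs_copyReg (O := O) (hρ f hf) s (h₃ m le_rfl) (h₃ (m + 1) (by omega))
  rw [h₁ f hf] at this
  refine this.mono ?_
  have := h₂ f hf
  simp
  omega

theorem nil : PT O V (fun _ => []) := by
  refine ⟨⟨0, by simp⟩, fun ρ m hρ => ⟨.skip, 1, fun γ s B h₁ h₂ h₃ => ⟨1, by simp, ?_⟩⟩⟩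
  rw [← h₃ m le_rfl, Function.update_eq_self]
  exact .skip s

theorem cons (b : Bool) (hf : PT O V f) : PT O V (fun γ => b :: f γ) := by
  refine ⟨?_, fun ρ m hρ => ?_⟩
  · obtain ⟨q, hq⟩ := hf.bound
    exact ⟨q + 1, fun γ B hB => by simpa using hq γ B hB⟩
  · obtain ⟨c, p, hc⟩ := hf.run ρ m hρ
    refine ⟨.seq c (.push m b), p + 1, fun γ s B h₁ h₂ h₃ => ?_⟩
    have := (hc γ s B h₁ h₂ h₃).seq (Runs.push m b _)
    simpa using this

theorem tail (hf : PT O V f) : PT O V (fun γ => (f γ).tail) := by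
  refine ⟨?_, fun ρ m hρ => ?_⟩
  · obtain ⟨q, hq⟩ := hf.bound
    exact ⟨q, fun γ B hB => by have := hq γ B hB; simp; omega⟩
  · obtain ⟨c, p, hc⟩ := hf.run ρ m hρ
    refine ⟨.seq c (.pop m), p + 1, fun γ s B h₁ h₂ h₃ => ?_⟩
    have := (hc γ s B h₁ h₂ h₃).seq (Runs.pop m _)
    simpa using this

open Classical in
theorem query (hf : PT O V f) : PT O V (fun γ => [decide (f γ ∈ O)]) := by
  refine ⟨⟨1, by simp⟩, fun ρ m hρ => ?_⟩
  obtain ⟨c, p, hc⟩ := hf.run ρ m hρ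
  refine ⟨.seq c (.query m), p + 1, fun γ s B h₁ h₂ h₃ => ?_⟩
  have h1 : Runs O (.query m) (Function.update s m (f γ))
      (Function.update s m [decide (f γ ∈ O)]) 1 := by
    refine ⟨1, le_rfl, ?_⟩
    by_cases h : f γ ∈ O
    · have := Exec.queryYes (O := O) m (Function.update s m (f γ)) (by simpa using h)
      simpa [h] using this
    · have := Exec.queryNo (O := O) m (Function.update s m (f γ)) (by simpa using h)
      simpa [h] using this
  have := (hc γ s B h₁ h₂ h₃).seq h1
  simpa using this

theorem select {e : Γ → Word} (he : PT O V e) (hf : PT O V f) (hg : PT O V g) (hh : PT O V h) :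
    PT O V (fun γ => OracleKernel.select (e γ) (f γ) (g γ) (h γ)) := by
  refine ⟨?_, fun ρ m hρ => ?_⟩
  · obtain ⟨q₀, hq₀⟩ := hf.bound
    obtain ⟨q₁, hq₁⟩ := hg.bound
    obtain ⟨q₂, hq₂⟩ := hh.bound
    refine ⟨q₀ + q₁ + q₂, fun γ B hB => ?_⟩
    have h₀ := hq₀ γ B hB
    have h₁ := hq₁ γ B hB
    have h₂ := hq₂ γ B hB
    simp only [OracleKernel.select, Polynomial.eval_add]
    split <;> omega
  · obtain ⟨c, p, hc⟩ := he.run ρ m hρ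
    obtain ⟨q, hq⟩ := he.bound
    obtain ⟨c₀, p₀, hc₀⟩ := hf.run ρ m hρ
    obtain ⟨c₁, p₁, hc₁⟩ := hg.run ρ m hρ
    obtain ⟨c₂, p₂, hc₂⟩ := hh.run ρ m hρ
    refine ⟨.seq c (.branch m (.seq (clearReg m) c₀) (.seq (clearReg m) c₁)
      (.seq (clearReg m) c₂)), p + (2 * q + 1 + p₀ + p₁ + p₂ + 1), fun γ s B h₁ h₂ h₃ => ?_⟩
    have hclear := runs_clearReg (O := O) m (Function.update s m (e γ))
    -- Register `m` was empty, so clearing the tested word restores the initial state, from which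
    -- each branch is known to run.
    have hs : Function.update (Function.update s m (e γ)) m [] = s := by
      rw [← h₃ m le_rfl]; simp
    rw [hs, Function.update_self] at hclear
    have hl := hq γ B h₂
    rw [Polynomial.eval_add]
    refine (hc γ s B h₁ h₂ h₃).seq ?_
    rw [Polynomial.eval_add, Polynomial.eval_one]
    refine Runs.branch (fun h => ?_) (fun h => ?_) (fun h => ?_) <;>
      rw [Function.update_self] at h
    · exact (hclear.seq (hc₀ γ s B h₁ h₂ h₃)).of_eq (by simp [OracleKernel.select, h])
        (by simp; omega)
    · obtain ⟨w, hw⟩ : ∃ w, e γ = false :: w := by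
        cases h' : e γ <;> simp_all
      exact (hclear.seq (hc₁ γ s B h₁ h₂ h₃)).of_eq (by simp [OracleKernel.select, hw])
        (by simp; omega)
    · obtain ⟨w, hw⟩ : ∃ w, e γ = true :: w := by
        cases h' : e γ <;> simp_all
      exact (hclear.seq (hc₂ γ s B h₁ h₂ h₃)).of_eq (by simp [OracleKernel.select, hw])
        (by simp; omega)

theorem lift (hf : PT O V f) : PT O (lift V) (fun z => f z.1) := by
  refine ⟨?_, fun ρ m hρ => ?_⟩
  · obtain ⟨q, hq⟩ := hf.bound
    exact ⟨q, fun z B hB => hq z.1 B fun v hv => hB _ (Or.inr ⟨v, hv, rfl⟩)⟩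
  · obtain ⟨c, p, hc⟩ := hf.run (fun v => ρ (fun z => v z.1)) m
      (fun v hv => hρ _ (Or.inr ⟨v, hv, rfl⟩))
    exact ⟨c, p, fun z s B h₁ h₂ h₃ => hc z.1 s B (fun v hv => h₁ _ (Or.inr ⟨v, hv, rfl⟩))
      (fun v hv => h₂ _ (Or.inr ⟨v, hv, rfl⟩)) h₃⟩

/-- `A (γ, i)` is the accumulator after `i` rounds, and a round may read it together with the
counter. The bound `hA` on all intermediate values is essential: a polynomial-time round could
square the length each time. -/
theorem loop {n : Γ → Word} {A : Γ × ℕ → Word} (hn : PT O V n) (h₀ : PT O V (fun γ => A (γ, 0)))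
    (h : PT O (insert A (OracleKernel.lift V)) (fun z => A (z.1, z.2 + 1)))
    (hA : ∃ q : Polynomial ℕ, ∀ γ B i, (∀ v ∈ V, (v γ).length ≤ B) → i ≤ (n γ).length →
      (A (γ, i)).length ≤ q.eval B) :
    PT O V (fun γ => A (γ, (n γ).length)) := by
  classical
  obtain ⟨q, hq⟩ := hA
  refine ⟨⟨q, fun γ B hB => hq γ B _ hB le_rfl⟩, fun ρ m hρ => ?_⟩
  obtain ⟨c₀, p₀, hc₀⟩ := h₀.run ρ m hρ
  obtain ⟨c₁, p₁, hc₁⟩ := hn.run ρ (m + 1) (fun v hv => (hρ v hv).trans (by omega))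
  obtain ⟨q₁, hq₁⟩ := hn.bound
  -- A lifted value is sent to its old register by evaluating at counter `0`. If `A` coincides with
  -- the counter or a lifted value, register `m` serves both, with the correct content.
  let ρ' : (Γ × ℕ → Word) → ℕ := fun u =>
    if u = A then m else if u = idx Γ then m + 2 else ρ (fun γ => u (γ, 0))
  obtain ⟨c, p, hc⟩ := h.run ρ' (m + 3) (by
    intro u hu
    simp only [ρ']
    split_ifs with h1 h2
    · omega
    · omega
    · obtain rfl | rfl | ⟨v, hv, rfl⟩ := hu
      · exact absurd rfl h1
      · exact absurd rfl h2
      · exact (hρ v hv).trans (by omega))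
  let body : Program := .seq c (.seq (clearReg m) (.seq (moveReg (m + 3) (m + 4) m)
    (.seq (.push (m + 2) true) (.pop (m + 1)))))
  -- Budget of one round: computing the new accumulator from values of size at most `B + q + q₁`,
  -- clearing the old one, moving the new one into place, and updating the two counters.
  let P : Polynomial ℕ := p.comp (.X + q + q₁) + (2 * q + 1) + (8 * q + 2) + 2
  refine ⟨.seq c₀ (.seq c₁ (.seq (.loop (m + 1) body) (clearReg (m + 2)))),
    p₀ + (p₁ + ((q₁ * (P + 1) + 1) + (2 * q₁ + 1))), fun γ s B h₁ h₂ h₃ => ?_⟩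
  have hlen := hq₁ γ B h₂
  set N := (n γ).length with hN
  -- Before round `i`, register `m` holds the accumulator, `m + 1` the unread rest of `n γ` that
  -- controls the loop, and `m + 2` the number `i` in unary.
  let σ : ℕ → State := fun i => Function.update (Function.update (Function.update s m (A (γ, i)))
    (m + 1) ((n γ).drop i)) (m + 2) (List.replicate i true)
  have hbody : ∀ i < N, Runs O body (σ i) (σ (i + 1)) (P.eval B) := by
    intro i hi
    have hAi := hq γ B i h₂ hi.le
    have hAi' := hq γ B (i + 1) h₂ hi
    have e₁ : Runs O c (σ i) (Function.update (σ i) (m + 3) (A (γ, i + 1)))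
        (p.eval (B + q.eval B + q₁.eval B)) := by
      refine hc (γ, i) (σ i) _ ?_ ?_ ?_
      · intro u hu
        simp only [ρ']
        split_ifs with h1 h2
        · subst h1; simp [σ]
        · subst h2; simp [σ, idx]
        · obtain rfl | rfl | ⟨v, hv, rfl⟩ := hu
          · exact absurd rfl h1
          · exact absurd rfl h2
          · have : ρ v < m := hρ v hv
            change σ i (ρ v) = v γ
            simp only [σ]
            rw [Function.update_of_ne (by omega), Function.update_of_ne (by omega),
              Function.update_of_ne (by omega)]
            exact h₁ v hv
      · rintro u (rfl | rfl | ⟨v, hv, rfl⟩)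
        · omega
        · simp [idx]; omega
        · have := h₂ v hv
          simp only; omega
      · intro j hj
        simp only [σ]
        rw [Function.update_of_ne (by omega), Function.update_of_ne (by omega),
          Function.update_of_ne (by omega)]
        exact h₃ j (by omega)
    have e₂ := runs_clearReg (O := O) m (Function.update (σ i) (m + 3) (A (γ, i + 1)))
    have e₃ := runs_moveReg (O := O) (r := m + 3) (x := m + 4) (a := m) (by omega) (by omega)
      (by omega) (Function.update (Function.update (σ i) (m + 3) (A (γ, i + 1))) m [])
      (by simp [σ, h₃]) (by simp)
    have e := e₁.seq (e₂.seq (e₃.seq ((Runs.push (m + 2) true _).seq (Runs.pop (m + 1) _))))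
    refine e.of_eq ?_ ?_
    · funext j
      have := h₃ (m + 3) (by omega)
      by_cases j0 : j = m
      · subst j0; simp [σ]
      by_cases j1 : j = m + 1
      · subst j1; simp [σ]
      by_cases j2 : j = m + 2
      · subst j2; simp [σ, List.replicate_succ]
      by_cases j3 : j = m + 3
      · subst j3; simp [σ, this]
      simp [σ, j0, j1, j2, j3]
    · simp [σ, P]
      omega
  have hloop := Runs.loop (O := O) (r := m + 1) N σ (fun i hi => by simp [σ]; omega)
    (by simp [σ, N]) hbody
  have hstart : σ 0 = Function.update (Function.update s m (A (γ, 0))) (m + 1) (n γ) := by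
    funext j
    have := h₃ (m + 2) (by omega)
    by_cases j2 : j = m + 2
    · subst j2; simp [σ, this]
    simp [σ, j2]
  rw [hstart] at hloop
  have e₀ := hc₀ γ s B h₁ h₂ h₃
  have e₁ := hc₁ γ (Function.update s m (A (γ, 0))) B (fun v hv => by
    rw [Function.update_of_ne (hρ v hv).ne]; exact h₁ v hv) h₂ (fun j hj => by
    rw [Function.update_of_ne (by omega)]; exact h₃ j (by omega))
  have e := e₀.seq (e₁.seq (hloop.seq (runs_clearReg (O := O) (m + 2) (σ N))))
  refine e.of_eq ?_ ?_
  · funext j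
    have := h₃ (m + 1) (by omega)
    have := h₃ (m + 2) (by omega)
    by_cases j0 : j = m
    · subst j0; simp [σ, N]
    by_cases j1 : j = m + 1
    · subst j1; simpa [σ, N]
    by_cases j2 : j = m + 2
    · subst j2; simpa [σ]
    simp [σ, j0, j1, j2]
  · have : N * (P.eval B + 1) ≤ q₁.eval B * (P.eval B + 1) := Nat.mul_le_mul_right _ hlen
    simp [σ]
    omega

end PT
end OracleKernel

/-! ### Closure properties: unary numbers, truth values, bounded iteration and quantification. -/

namespace OracleKernel

/-- Polynomial-time computability of a natural number in unary. -/
def PTNat (O : Set Word) {Γ : Type} (V : Set (Γ → Word)) (f : Γ → ℕ) : Prop :=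
  PT O V (fun γ => List.replicate (f γ) true)

/-- Polynomial-time computability of a truth value. -/
def PTBool (O : Set Word) {Γ : Type} (V : Set (Γ → Word)) (f : Γ → Bool) : Prop :=
  PT O V (fun γ => [f γ])

section Closure

variable {O : Set Word} {Γ : Type} {V : Set (Γ → Word)} {f g : Γ → Word} {m n : Γ → ℕ}
  {b c : Γ → Bool}

theorem PT.of_eq (hf : PT O V f) (h : ∀ γ, f γ = g γ) : PT O V g :=
  (funext h : f = g) ▸ hf

theorem PTBool.of_pt (hf : PT O V f) (h : ∀ γ, f γ = [b γ]) : PTBool O V b :=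
  hf.of_eq h

theorem PTBool.of_eq (hb : PTBool O V b) (h : ∀ γ, b γ = c γ) : PTBool O V c :=
  (funext h : b = c) ▸ hb

theorem PTNat.of_pt (hf : PT O V f) (h : ∀ γ, f γ = List.replicate (n γ) true) : PTNat O V n :=
  hf.of_eq h

theorem PTNat.lift (hn : PTNat O V n) : PTNat O (lift V) (fun z => n z.1) :=
  PT.lift hn

theorem PTNat.counter : PTNat O (OracleKernel.lift V) (fun z => z.2) :=
  PT.var (Or.inl rfl)

theorem PTNat.const (k : ℕ) : PTNat O V (fun _ => k) := by
  induction k with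
  | zero => exact PT.nil
  | succ k ih => exact PT.cons true ih

theorem PTNat.succ (hn : PTNat O V n) : PTNat O V (fun γ => n γ + 1) :=
  PT.cons true hn

theorem PTBool.const (x : Bool) : PTBool O V (fun _ => x) :=
  PT.cons x PT.nil

theorem PT.bif (hb : PTBool O V b) (hf : PT O V f) (hg : PT O V g) :
    PT O V (fun γ => bif b γ then f γ else g γ) :=
  (PT.select hb PT.nil hg hf).of_eq fun γ => by cases b γ <;> rfl

theorem PTBool.bif {a : Γ → Bool} (ha : PTBool O V a) (hb : PTBool O V b) (hc : PTBool O V c) :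
    PTBool O V (fun γ => bif a γ then b γ else c γ) :=
  .of_pt (PT.bif ha hb hc) fun γ => by cases a γ <;> rfl

theorem PTBool.not (hb : PTBool O V b) : PTBool O V (fun γ => !b γ) :=
  (PTBool.bif hb (.const false) (.const true)).of_eq fun γ => by cases b γ <;> rfl

theorem PTBool.and (hb : PTBool O V b) (hc : PTBool O V c) : PTBool O V (fun γ => b γ && c γ) :=
  (PTBool.bif hb hc (.const false)).of_eq fun γ => by cases b γ <;> rfl

theorem PTBool.or (hb : PTBool O V b) (hc : PTBool O V c) : PTBool O V (fun γ => b γ || c γ) :=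
  (PTBool.bif hb (.const true) hc).of_eq fun γ => by cases b γ <;> rfl

theorem PTBool.beq (hb : PTBool O V b) (hc : PTBool O V c) : PTBool O V (fun γ => b γ == c γ) :=
  (PTBool.bif hb hc hc.not).of_eq fun γ => by cases b γ <;> cases c γ <;> rfl

theorem PT.length (hf : PT O V f) : PTNat O V (fun γ => (f γ).length) := by
  refine PT.loop (A := idx Γ) hf PT.nil (PT.cons true (PT.var (Or.inl rfl))) ?_
  obtain ⟨q, hq⟩ := hf.bound
  exact ⟨q, fun γ B i hB hi => by have := hq γ B hB; simp [idx]; omega⟩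

/-- Since `step` never lengthens a word, all intermediate values stay within the size of the start
value, as `PT.loop` requires. -/
theorem PT.iterate {step : Word → Word} (hn : PTNat O V n) (hf : PT O V f)
    (hstep : ∀ {W : Set (Γ × ℕ → Word)} {g : Γ × ℕ → Word}, PT O W g →
      PT O W (fun z => step (g z)))
    (hlen : ∀ w, (step w).length ≤ w.length) : PT O V (fun γ => step^[n γ] (f γ)) := by
  have := PT.loop (A := fun z => step^[z.2] (f z.1)) hn hf
    ((hstep (PT.var (Or.inl rfl))).of_eq fun z => (Function.iterate_succ_apply' ..).symm) (by
    obtain ⟨q, hq⟩ := hf.bound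
    refine ⟨q, fun γ B i hB _ => le_trans ?_ (hq γ B hB)⟩
    induction i with
    | zero => exact le_rfl
    | succ i ih =>
      simp only [Function.iterate_succ_apply']
      exact (hlen _).trans (ih (by omega)))
  simpa using this

theorem tail_iterate (k : ℕ) (w : Word) : List.tail^[k] w = w.drop k := by
  induction k generalizing w with
  | zero => rfl
  | succ k ih => rw [Function.iterate_succ_apply, ih, List.drop_tail]

theorem PT.drop (hn : PTNat O V n) (hf : PT O V f) : PT O V (fun γ => (f γ).drop (n γ)) :=
  (PT.iterate hn hf PT.tail (fun w => by simp)).of_eq fun γ => tail_iterate ..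

/-- Pushing the symbols of `f γ` one by one onto `g γ` reverses them; applying this twice gives
concatenation. -/
theorem PT.reverse_append (hf : PT O V f) (hg : PT O V g) :
    PT O V (fun γ => (f γ).reverse ++ g γ) := by
  have := PT.loop (A := fun z => ((f z.1).take z.2).reverse ++ g z.1) hf
    (hg.of_eq fun γ => by simp)
    (((PT.drop .counter hf.lift).mono (Set.subset_insert _ _)).select (PT.var (Or.inl rfl))
      (PT.cons false (PT.var (Or.inl rfl))) (PT.cons true (PT.var (Or.inl rfl))) |>.of_eq ?_) ?_
  · simpa using this
  · rintro ⟨γ, i⟩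
    rw [List.take_add_one, ← List.head?_drop]
    rcases (f γ).drop i with _ | ⟨_ | _, w⟩ <;> simp [OracleKernel.select]
  · obtain ⟨q, hq⟩ := hf.bound
    obtain ⟨q', hq'⟩ := hg.bound
    refine ⟨q + q', fun γ B i hB _ => ?_⟩
    have := hq γ B hB
    have := hq' γ B hB
    simp
    omega

theorem PT.reverse (hf : PT O V f) : PT O V (fun γ => (f γ).reverse) :=
  (PT.reverse_append hf PT.nil).of_eq fun γ => by simp

theorem PT.append (hf : PT O V f) (hg : PT O V g) : PT O V (fun γ => f γ ++ g γ) :=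
  (PT.reverse_append hf.reverse hg).of_eq fun γ => by simp

theorem PT.flatMap {f : Γ × ℕ → Word} (hn : PTNat O V n) (hf : PT O (OracleKernel.lift V) f) :
    PT O V (fun γ => (List.range (n γ)).flatMap (fun i => f (γ, i))) := by
  have := PT.loop (A := fun z => (List.range z.2).flatMap (fun i => f (z.1, i))) hn PT.nil
    ((PT.append (PT.var (Or.inl rfl)) (hf.mono (Set.subset_insert _ _))).of_eq fun z => by
      simp [List.range_succ]) ?_
  · simpa using this
  · obtain ⟨q, hq⟩ := hf.bound
    obtain ⟨p, hp⟩ := PT.bound hn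
    -- At most `p` blocks, each computed with a counter of size at most `p` among its known values.
    refine ⟨p * q.comp (.X + p), fun γ B i hB hi => ?_⟩
    have hp' := hp γ B hB
    have : ∀ x ∈ (List.range i).map (fun j => (f (γ, j)).length), x ≤ q.eval (B + p.eval B) := by
      intro x hx
      obtain ⟨j, hj, rfl⟩ := List.mem_map.1 hx
      rw [List.mem_range] at hj
      refine hq (γ, j) _ ?_
      rintro v (rfl | ⟨v, hv, rfl⟩)
      · simp [idx] at *; omega
      · exact (hB v hv).trans (by omega)
    have := List.sum_le_card_nsmul _ _ this
    simp only [List.length_map, List.length_range, smul_eq_mul] at this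
    simp only [List.length_flatMap, Polynomial.eval_mul, Polynomial.eval_comp,
      Polynomial.eval_add, Polynomial.eval_X]
    exact this.trans (Nat.mul_le_mul_right _ (hi.trans hp'))

theorem PTNat.add (hm : PTNat O V m) (hn : PTNat O V n) : PTNat O V (fun γ => m γ + n γ) :=
  (PT.append hm hn).of_eq fun γ => by simp

theorem PT.isEmpty (hf : PT O V f) : PTBool O V (fun γ => (f γ).isEmpty) :=
  .of_pt (PT.select hf (PTBool.const true) (PTBool.const false) (PTBool.const false)) fun γ => by
    rcases f γ with _ | ⟨_ | _, w⟩ <;> rfl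

theorem PT.getD (hf : PT O V f) (hn : PTNat O V n) :
    PTBool O V (fun γ => (f γ).getD (n γ) false) :=
  .of_pt (PT.select (PT.drop hn hf) (PTBool.const false) (PTBool.const false)
    (PTBool.const true)) fun γ => by
    rw [List.getD_eq_getElem?_getD, ← List.head?_drop]
    rcases (f γ).drop (n γ) with _ | ⟨_ | _, w⟩ <;> rfl

theorem PTNat.le (hm : PTNat O V m) (hn : PTNat O V n) :
    PTBool O V (fun γ => decide (m γ ≤ n γ)) :=
  (PT.isEmpty (PT.drop hn hm)).of_eq fun γ => by
    simp [Nat.sub_eq_zero_iff_le]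

theorem PTNat.lt (hm : PTNat O V m) (hn : PTNat O V n) :
    PTBool O V (fun γ => decide (m γ < n γ)) :=
  PTNat.le hm.succ hn

theorem PTBool.countP {b : Γ × ℕ → Bool} (hn : PTNat O V n)
    (hb : PTBool O (OracleKernel.lift V) b) :
    PTNat O V (fun γ => (List.range (n γ)).countP (fun i => b (γ, i))) :=
  .of_pt (PT.flatMap hn (PT.bif hb (PTBool.const true) PT.nil)) fun γ => by
    induction List.range (n γ) with
    | nil => rfl
    | cons i l ih =>
      rw [List.flatMap_cons, ih, List.countP_cons]
      cases b (γ, i) <;> simp [List.replicate_succ]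

theorem PTBool.any {b : Γ × ℕ → Bool} (hn : PTNat O V n)
    (hb : PTBool O (OracleKernel.lift V) b) :
    PTBool O V (fun γ => (List.range (n γ)).any (fun i => b (γ, i))) :=
  (PTNat.lt (PTNat.const 0) (PTBool.countP hn hb)).of_eq fun γ => by
    rw [Bool.eq_iff_iff]
    simp

theorem PTBool.all {b : Γ × ℕ → Bool} (hn : PTNat O V n)
    (hb : PTBool O (OracleKernel.lift V) b) :
    PTBool O V (fun γ => (List.range (n γ)).all (fun i => b (γ, i))) :=
  (PTBool.any hn hb.not).not.of_eq fun γ => by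
    rw [Bool.eq_iff_iff]
    simp

theorem PT.eq (hf : PT O V f) (hg : PT O V g) : PTBool O V (fun γ => decide (f γ = g γ)) :=
  ((PTNat.le hf.length hg.length).and ((PTNat.le hg.length hf.length).and
    (PTBool.all hf.length ((hf.lift.getD .counter).beq (hg.lift.getD .counter))))).of_eq fun γ => by
    rw [Bool.eq_iff_iff]
    simp only [Bool.and_eq_true, decide_eq_true_eq,
      List.all_eq_true, List.mem_range, beq_iff_eq]
    refine ⟨fun ⟨h, h', H⟩ => List.ext_getElem (le_antisymm h h') fun i h₁ h₂ => ?_, ?_⟩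
    · simpa [h₁, h₂] using H i h₁
    · rintro h
      simp [h]

theorem flatMap_range_eq (w : Word) (F : Bool → Word) :
    (List.range w.length).flatMap (fun i => F (w.getD i false)) = w.flatMap F := by
  rw [← List.flatMap_map (fun i => w.getD i false) F]
  congr 1
  exact List.ext_getElem (by simp) (by simp +contextual)

theorem PT.field (hf : PT O V f) : PT O V (fun γ => Instance.field (f γ)) :=
  (PT.append (PT.flatMap hf.length (PT.cons true (hf.lift.getD .counter)))
    (PTBool.const false)).of_eq fun γ => by
    rw [Instance.field, ← flatMap_range_eq]

end Closure
end OracleKernel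

namespace OracleKernel

open Instance (field)

/-! ### Parsing words -/

/-- Remove the first data symbol of a field. -/
def dropSymbol (w : Word) : Word :=
  select w w w (select w.tail w w.tail.tail w.tail.tail)

/-- The first data symbol of a field, if there is one. -/
def firstSymbol (w : Word) : Word :=
  select w [] [] (select w.tail [] [false] [true])

/-- The content of the first field of a word. -/
def fieldHead (w : Word) : Word :=
  (List.range w.length).flatMap fun i => firstSymbol (dropSymbol^[i] w)

/-- The remainder of a word after its first field. -/
def fieldTail (w : Word) : Word :=
  (dropSymbol^[w.length] w).tail

theorem length_dropSymbol_le (w : Word) : (dropSymbol w).length ≤ w.length := by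
  rcases w with _ | ⟨_ | _, _ | ⟨_ | _, w⟩⟩ <;> simp [dropSymbol, select]
  all_goals omega

theorem length_fieldTail_le (w : Word) : (fieldTail w).length ≤ w.length := by
  have : ∀ i, (dropSymbol^[i] w).length ≤ w.length := by
    intro i
    induction i with
    | zero => exact le_rfl
    | succ i ih =>
      rw [Function.iterate_succ_apply']
      exact (length_dropSymbol_le _).trans ih
  have := this w.length
  simp only [fieldTail, List.length_tail]
  omega

theorem field_cons (b : Bool) (a : Word) : field (b :: a) = true :: b :: field a := rfl

/-- A word starting with the end mark `false` is a fixed point of `dropSymbol`, so surplus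
iterations do no harm. This is why the parsers can iterate as often as the word is long. -/
theorem dropSymbol_iterate (a y : Word) (i : ℕ) :
    dropSymbol^[i] (field a ++ y) = field (a.drop i) ++ y := by
  induction i generalizing a with
  | zero => rfl
  | succ i ih =>
    rw [Function.iterate_succ_apply]
    rcases a with _ | ⟨b, a⟩
    · exact (ih []).trans (by simp)
    · rw [List.drop_succ_cons, ← ih a]
      cases b <;> rfl

theorem firstSymbol_field (a y : Word) : firstSymbol (field a ++ y) = a.take 1 := by
  rcases a with _ | ⟨_ | _, a⟩ <;> rfl

theorem length_field (a : Word) : (field a).length = 2 * a.length + 1 := by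
  induction a with
  | nil => rfl
  | cons b a ih => rw [field_cons, List.length_cons, List.length_cons, ih]; simp; omega

theorem fieldHead_field_append (a y : Word) : fieldHead (field a ++ y) = a := by
  have : ∀ N, (List.range N).flatMap (fun i => firstSymbol (dropSymbol^[i] (field a ++ y))) =
      a.take N := by
    intro N
    induction N with
    | zero => rfl
    | succ N ih =>
      rw [List.range_succ, List.flatMap_append, ih, List.flatMap_singleton, dropSymbol_iterate,
        firstSymbol_field, List.take_add]
  rw [fieldHead, this]
  refine List.take_of_length_le ?_
  have := length_field a
  simp
  omega

theorem fieldTail_field_append (a y : Word) : fieldTail (field a ++ y) = y := by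
  rw [fieldTail, dropSymbol_iterate, List.drop_of_length_le]
  · rfl
  · have := length_field a
    simp
    omega

/-- Triangular numbers. -/
def tri : ℕ → ℕ
  | 0 => 0
  | n + 1 => tri n + n

theorem tri_mono {m n : ℕ} (h : m ≤ n) : tri m ≤ tri n := by
  induction h with
  | refl => exact le_rfl
  | step _ ih => exact ih.trans (Nat.le_add_right ..)

theorem tri_eq_length (n : ℕ) :
    (List.range n).flatMap (fun i => List.replicate i true) = List.replicate (tri n) true := by
  induction n with
  | zero => rfl
  | succ n ih => simp [List.range_succ, ih, tri]

/-! ### Instances as words -/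

/-- The binary length of the sequence. -/
def lenBits (x : Word) : Word := fieldHead x

/-- The characteristic vector of the first vertex cover. -/
def sBits (x : Word) : Word := fieldHead (fieldTail x)

/-- The characteristic vector of the second vertex cover. -/
def tBits (x : Word) : Word := fieldHead (fieldTail (fieldTail x))

/-- The `i`th instance of SATISFIABILITY. -/
def pairWord (x : Word) (i : ℕ) : Word :=
  fieldHead (fieldTail^[i] (fieldTail (fieldTail (fieldTail x))))

/-- Some natural number has the binary expansion `b`. -/
def isBits (b : Word) : Bool := !decide (b.drop b.tail.length = [false])

/-- The word `x` encodes an instance. -/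
def isInstance (x : Word) : Bool :=
  isBits (lenBits x) &&
    (decide (List.replicate (sBits x).length true = List.replicate (tBits x).length true) &&
    decide (field (lenBits x) ++ (field (sBits x) ++ (field (tBits x) ++
      (List.range (tri (sBits x).length)).flatMap fun i => field (pairWord x i))) = x))

open Classical in
/-- The answers for all pairs of vertices. -/
noncomputable def edgeBits (x : Word) : Word :=
  (List.range (tri (sBits x).length)).flatMap fun i => [decide (pairWord x i ∈ SAT)]

/-! ### The kernelization on words

The word `e` holds the adjacency bits of all pairs of vertices, `s` and `t` are characteristic
vectors, and `n` is the number of vertices. -/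

/-- The pairs are listed row by row: row `v` starts at position `tri v` and holds the pairs `u < v`.
-/
def edge (e : Word) (i j : ℕ) : Bool :=
  bif decide (i < j) then e.getD (tri j + i) false
  else bif decide (j < i) then e.getD (tri i + j) false else false

def isCoverWord (e : Word) (n : ℕ) (s : Word) : Bool :=
  (List.range n).all fun i => (List.range n).all fun j =>
    !edge e i j || (s.getD i false || s.getD j false)

/-- Minimality is tested locally, through the criterion of `minimal_isCover_iff`. -/
def isMinCover (e : Word) (n : ℕ) (s : Word) : Bool :=
  isCoverWord e n s && (List.range n).all fun i => !s.getD i false ||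
    (List.range n).any fun j => edge e i j && !s.getD j false

def sizeLE (n : ℕ) (s : Word) (k : ℕ) : Bool :=
  decide ((List.range n).countP (fun i => s.getD i false) ≤ k)

def inUnion (s t : Word) (i : ℕ) : Bool := s.getD i false || t.getD i false

/-- Vertex `w` belongs to the kernel: it is in one of the covers or among the first `k + 1`
neighbours of a vertex in one of the covers. -/
def keep (e : Word) (n : ℕ) (s t : Word) (k w : ℕ) : Bool :=
  inUnion s t w || (List.range n).any fun v => inUnion s t v && (edge e v w &&
    decide ((List.range w).countP (fun u => edge e v u) ≤ k))

def restrict (P : ℕ → Bool) (n : ℕ) (s : Word) : Word :=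
  (List.range n).flatMap fun i => bif P i then [s.getD i false] else []

/-- Truncate the length of the sequence to a number of at most `m` bits. -/
def capBits (m : ℕ) (b : Word) : Word :=
  bif decide (b.length ≤ m) then b else List.replicate m true

/-- `[]` encodes the empty formula, which is satisfiable, and `[true]` encodes no formula; they
replace the original words, whose lengths are unbounded in `k`. -/
def kernelPairs (P : ℕ → Bool) (n : ℕ) (e : Word) : Word :=
  (List.range n).flatMap fun v => bif P v then
    (List.range v).flatMap (fun u => bif P u then
      field (bif edge e v u then [] else [true]) else []) else []

/-- With `m` kept vertices the cap is `m + 1` bits because a block of `m + 1` ones has value at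
least `2 ^ m`, enough for a path through all vertex sets. -/
def kernelWord (e : Word) (n : ℕ) (b s t : Word) (k : ℕ) : Word :=
  field (capBits ((List.range n).countP (keep e n s t k) + 1) b) ++
    (field (restrict (keep e n s t k) n s) ++ (field (restrict (keep e n s t k) n t) ++
      kernelPairs (keep e n s t k) n e))

def isGood (e : Word) (n : ℕ) (s t : Word) (k : ℕ) : Bool :=
  isMinCover e n s && (isMinCover e n t && (sizeLE n s k && sizeLE n t k))

noncomputable def kernel (x : Word) (k : ℕ) : Word :=
  bif isInstance x && isGood (edgeBits x) (sBits x).length (sBits x) (tBits x) k then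
    kernelWord (edgeBits x) (sBits x).length (lenBits x) (sBits x) (tBits x) k
  else []

/-! ### The kernelization in polynomial time -/

section PolyTime

variable {O : Set Word} {Γ : Type} {V : Set (Γ → Word)} {x e s t : Γ → Word} {i j k n m : Γ → ℕ}

theorem PTNat.outerCounter : PTNat O (OracleKernel.lift (OracleKernel.lift V)) (fun z => z.1.2) :=
  PTNat.lift PTNat.counter

theorem PT.dropSymbol (h : PT O V x) : PT O V (fun γ => dropSymbol (x γ)) :=
  .select h h h (.select h.tail h h.tail.tail h.tail.tail)

theorem PT.firstSymbol (h : PT O V x) : PT O V (fun γ => firstSymbol (x γ)) :=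
  .select h .nil .nil (.select h.tail .nil (.cons false .nil) (.cons true .nil))

theorem PT.fieldHead (h : PT O V x) : PT O V (fun γ => fieldHead (x γ)) :=
  .flatMap (f := fun z : Γ × ℕ => OracleKernel.firstSymbol (OracleKernel.dropSymbol^[z.2] (x z.1)))
    h.length
    (.firstSymbol (.iterate .counter h.lift .dropSymbol length_dropSymbol_le))

theorem PT.fieldTail (h : PT O V x) : PT O V (fun γ => fieldTail (x γ)) :=
  .tail (.iterate h.length h .dropSymbol length_dropSymbol_le)

theorem PTNat.tri (hn : PTNat O V n) : PTNat O V (fun γ => tri (n γ)) :=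
  .of_pt (PT.flatMap hn (PTNat.counter (V := V))) fun _ => tri_eq_length _

theorem PT.sBits (h : PT O V x) : PT O V (fun γ => sBits (x γ)) := h.fieldTail.fieldHead

theorem PT.tBits (h : PT O V x) : PT O V (fun γ => tBits (x γ)) := h.fieldTail.fieldTail.fieldHead

theorem PT.pairWord (h : PT O V x) (hi : PTNat O V i) : PT O V (fun γ => pairWord (x γ) (i γ)) :=
  .fieldHead (.iterate hi h.fieldTail.fieldTail.fieldTail .fieldTail length_fieldTail_le)

theorem PTBool.isBits (h : PT O V x) : PTBool O V (fun γ => isBits (x γ)) :=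
  .not (.eq (.drop h.tail.length h) (.cons false .nil))

theorem PTBool.isInstance (h : PT O V x) : PTBool O V (fun γ => isInstance (x γ)) :=
  .and (.isBits h.fieldHead) (.and (.eq h.sBits.length h.tBits.length)
    (.eq (.append h.fieldHead.field (.append h.sBits.field (.append h.tBits.field
      (.flatMap (f := fun z : Γ × ℕ => field (OracleKernel.pairWord (x z.1) z.2)) h.sBits.length.tri
        (.field (.pairWord h.lift .counter)))))) h))

/-- This is the only use of the oracle in the kernelization: one query for each pair of vertices. -/
theorem PT.edgeBits (h : PT SAT V x) : PT SAT V (fun γ => edgeBits (x γ)) := by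
  classical
  exact .flatMap (f := fun z : Γ × ℕ => [decide (OracleKernel.pairWord (x z.1) z.2 ∈ SAT)])
    h.sBits.length.tri
    (.query (.pairWord h.lift .counter))

theorem PTBool.edge (he : PT O V e) (hi : PTNat O V i) (hj : PTNat O V j) :
    PTBool O V (fun γ => edge (e γ) (i γ) (j γ)) :=
  .bif (hi.lt hj) (he.getD (hj.tri.add hi)) (.bif (hj.lt hi) (he.getD (hi.tri.add hj)) (.const false))

theorem PTBool.isCoverWord (he : PT O V e) (hn : PTNat O V n) (hs : PT O V s) :
    PTBool O V (fun γ => isCoverWord (e γ) (n γ) (s γ)) :=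
  PTBool.all (b := fun z : Γ × ℕ => (List.range (n z.1)).all fun j =>
      !OracleKernel.edge (e z.1) z.2 j || ((s z.1).getD z.2 false || (s z.1).getD j false)) hn
    (PTBool.all (b := fun z : (Γ × ℕ) × ℕ => !OracleKernel.edge (e z.1.1) z.1.2 z.2 ||
        ((s z.1.1).getD z.1.2 false || (s z.1.1).getD z.2 false)) hn.lift
      (.or (.not (.edge he.lift.lift .outerCounter .counter))
        (.or (hs.lift.lift.getD .outerCounter) (hs.lift.lift.getD .counter))))

theorem PTBool.isMinCover (he : PT O V e) (hn : PTNat O V n) (hs : PT O V s) :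
    PTBool O V (fun γ => isMinCover (e γ) (n γ) (s γ)) :=
  .and (.isCoverWord he hn hs)
    (PTBool.all (b := fun z : Γ × ℕ => !(s z.1).getD z.2 false || (List.range (n z.1)).any fun j =>
        OracleKernel.edge (e z.1) z.2 j && !(s z.1).getD j false) hn
      (.or (.not (hs.lift.getD .counter))
        (PTBool.any (b := fun z : (Γ × ℕ) × ℕ =>
            OracleKernel.edge (e z.1.1) z.1.2 z.2 && !(s z.1.1).getD z.2 false) hn.lift
          (.and (.edge he.lift.lift .outerCounter .counter) (.not (hs.lift.lift.getD .counter))))))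

theorem PTBool.sizeLE (hn : PTNat O V n) (hs : PT O V s) (hk : PTNat O V k) :
    PTBool O V (fun γ => sizeLE (n γ) (s γ) (k γ)) :=
  PTNat.le (PTBool.countP (b := fun z : Γ × ℕ => (s z.1).getD z.2 false) hn
    (hs.lift.getD .counter)) hk

theorem PTBool.inUnion (hs : PT O V s) (ht : PT O V t) (hi : PTNat O V i) :
    PTBool O V (fun γ => inUnion (s γ) (t γ) (i γ)) :=
  .or (hs.getD hi) (ht.getD hi)

theorem PTBool.keep (he : PT O V e) (hn : PTNat O V n) (hs : PT O V s) (ht : PT O V t)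
    (hk : PTNat O V k) (hi : PTNat O V i) :
    PTBool O V (fun γ => keep (e γ) (n γ) (s γ) (t γ) (k γ) (i γ)) :=
  .or (.inUnion hs ht hi) (PTBool.any
    (b := fun z : Γ × ℕ => OracleKernel.inUnion (s z.1) (t z.1) z.2 &&
      (OracleKernel.edge (e z.1) z.2 (i z.1) &&
        decide ((List.range (i z.1)).countP (fun u => OracleKernel.edge (e z.1) z.2 u) ≤ k z.1))) hn
    (.and (.inUnion hs.lift ht.lift .counter) (.and (.edge he.lift .counter hi.lift)
      (PTNat.le (PTBool.countP
        (b := fun z : (Γ × ℕ) × ℕ => OracleKernel.edge (e z.1.1) z.1.2 z.2) hi.lift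
        (.edge he.lift.lift .outerCounter .counter)) hk.lift))))

theorem PT.restrict {P : Γ → ℕ → Bool} (hP : PTBool O (OracleKernel.lift V) (fun z => P z.1 z.2))
    (hn : PTNat O V n) (hs : PT O V s) : PT O V (fun γ => restrict (P γ) (n γ) (s γ)) :=
  .flatMap (f := fun z : Γ × ℕ => bif P z.1 z.2 then [(s z.1).getD z.2 false] else []) hn
    (.bif hP (hs.lift.getD .counter) .nil)

theorem PT.capBits (hm : PTNat O V m) (hx : PT O V x) : PT O V (fun γ => capBits (m γ) (x γ)) :=
  .bif (PTNat.le hx.length hm) hx hm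

/-- `P` is evaluated both in the outer and in the inner loop, hence the hypothesis over an arbitrary
context `Δ` above `Γ`. -/
theorem PT.kernelPairs {P : Γ → ℕ → Bool} (hP : ∀ {Δ : Type} (W : Set (Δ → Word)) (π : Δ → Γ)
      (i : Δ → ℕ), (∀ f, PT O V f → PT O W (fun δ => f (π δ))) → PTNat O W i →
      PTBool O W (fun δ => P (π δ) (i δ)))
    (hn : PTNat O V n) (he : PT O V e) : PT O V (fun γ => kernelPairs (P γ) (n γ) (e γ)) :=
  .flatMap (f := fun z : Γ × ℕ => bif P z.1 z.2 then (List.range z.2).flatMap (fun u =>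
      bif P z.1 u then Instance.field (bif OracleKernel.edge (e z.1) z.2 u then [] else [true])
      else []) else []) hn
    (.bif (hP _ (fun z => z.1) _ (fun _ h => h.lift) .counter)
      (PT.flatMap (f := fun z : (Γ × ℕ) × ℕ => bif P z.1.1 z.2 then
          Instance.field (bif OracleKernel.edge (e z.1.1) z.1.2 z.2 then [] else [true]) else [])
        .counter
        (.bif (hP (Δ := (Γ × ℕ) × ℕ) _ (fun z => z.1.1) _ (fun _ h => h.lift.lift) .counter)
          (.field (.bif (.edge he.lift.lift .outerCounter .counter) .nil (.cons true .nil)))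
          .nil)) .nil)

theorem PT.kernelWord (he : PT O V e) (hn : PTNat O V n) (hx : PT O V x) (hs : PT O V s)
    (ht : PT O V t) (hk : PTNat O V k) :
    PT O V (fun γ => kernelWord (e γ) (n γ) (x γ) (s γ) (t γ) (k γ)) := by
  have hkeep : PTBool O (OracleKernel.lift V)
      (fun z => OracleKernel.keep (e z.1) (n z.1) (s z.1) (t z.1) (k z.1) z.2) :=
    .keep he.lift hn.lift hs.lift ht.lift hk.lift .counter
  exact .append (.field (.capBits (.succ (PTBool.countP
      (b := fun z : Γ × ℕ => OracleKernel.keep (e z.1) (n z.1) (s z.1) (t z.1) (k z.1) z.2) hn hkeep))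
      hx))
    (.append (.field (.restrict hkeep hn hs)) (.append (.field (.restrict hkeep hn ht))
      (.kernelPairs (fun W π i h hi => .keep (h _ he) (h _ hn) (h _ hs) (h _ ht) (h _ hk) hi) hn he)))

theorem PTBool.isGood (he : PT O V e) (hn : PTNat O V n) (hs : PT O V s) (ht : PT O V t)
    (hk : PTNat O V k) : PTBool O V (fun γ => isGood (e γ) (n γ) (s γ) (t γ) (k γ)) :=
  .and (.isMinCover he hn hs) (.and (.isMinCover he hn ht)
    (.and (.sizeLE hn hs hk) (.sizeLE hn ht hk)))

theorem PT.kernel (hx : PT SAT V x) (hk : PTNat SAT V k) :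
    PT SAT V (fun γ => kernel (x γ) (k γ)) :=
  .bif (.and (.isInstance hx) (.isGood hx.edgeBits hx.sBits.length hx.sBits hx.tBits hk))
    (.kernelWord hx.edgeBits hx.sBits.length hx.fieldHead hx.sBits hx.tBits hk) .nil

end PolyTime

/-- A polynomial-time computable word yields a polynomial-time computable function that keeps the
parameter. -/
theorem PT.polyTimeComputable {O : Set Word} {F : Word → ℕ → Word}
    (h : ∀ {Γ : Type} {V : Set (Γ → Word)} {x : Γ → Word} {k : Γ → ℕ}, PT O V x → PTNat O V k →
      PT O V (fun γ => F (x γ) (k γ))) :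
    PolyTimeComputable O (fun z => (F z.1 z.2, z.2)) := by
  classical
  let a : Word × ℕ → Word := fun z => z.1
  let b : Word × ℕ → Word := fun z => List.replicate z.2 true
  -- Registers are assigned to functions, so the two inputs must be different functions to get
  -- different registers.
  have hab : b ≠ a := fun h => by simpa [a, b] using congrFun h ([], 1)
  have hF : PT O {a, b} (fun z : Word × ℕ => F z.1 z.2) :=
    h (x := fun z : Word × ℕ => z.1) (k := fun z => z.2) (.var (Or.inl rfl)) (PT.var (Or.inr rfl))
  obtain ⟨q, hq⟩ := hF.bound
  obtain ⟨c, p, hc⟩ := hF.run (fun v => if v = a then 0 else 1) 2 (by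
    intro v _
    split_ifs <;> omega)
  refine ⟨.seq c (.seq (clearReg 0) (moveReg 2 3 0)), p + ((2 * .X + 1) + (8 * q + 2)),
    fun x r => ?_⟩
  have hB : ∀ v ∈ ({a, b} : Set _), (v (x, r)).length ≤ x.length + r := by
    rintro v (rfl | rfl) <;> simp [a, b]
  have h₁ := hc (x, r) (inputState (x, r)) (x.length + r) (by
    rintro v (rfl | rfl)
    · simp [inputState, a]
    · simp [hab, inputState, b]) hB (fun j hj => by
    rw [inputState, if_neg (by omega), if_neg (by omega)])
  have h₂ := runs_clearReg (O := O) 0 (Function.update (inputState (x, r)) 2 (F x r))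
  have h₃ := runs_moveReg (O := O) (r := 2) (x := 3) (a := 0) (by omega) (by omega) (by omega)
    (Function.update (Function.update (inputState (x, r)) 2 (F x r)) 0 []) (by simp [inputState])
    (by simp)
  obtain ⟨t, ht, h⟩ := h₁.seq (h₂.seq h₃)
  refine ⟨_, t, h, ht.trans ?_, by simp, by simp [inputState]⟩
  have := hq (x, r) _ hB
  simp [inputState]
  dsimp only at this
  omega

theorem polyTimeComputable_kernel : PolyTimeComputable SAT (fun z => (kernel z.1 z.2, z.2)) :=
  PT.polyTimeComputable PT.kernel

end OracleKernel

namespace OracleKernel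

open Instance (field charVector)

/-! ### Instances and their encodings -/

/-- The instance given by functions on the natural numbers. -/
def Instance.ofNat (len n : ℕ) (p q : ℕ → Bool) (F : ℕ → ℕ → Word) : Instance where
  n := n
  I v u := F v u
  S := Finset.univ.filter fun v => p v = true
  T := Finset.univ.filter fun v => q v = true
  len := len

theorem Instance.ofNat_congr {len n : ℕ} {p q p' q' : ℕ → Bool} {F F' : ℕ → ℕ → Word}
    (hp : ∀ i < n, p i = p' i) (hq : ∀ i < n, q i = q' i)
    (hF : ∀ v < n, ∀ u < v, F v u = F' v u) :
    Instance.ofNat len n p q F = Instance.ofNat len n p' q' F' := by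
  simp only [Instance.ofNat, Instance.mk.injEq, heq_eq_eq, true_and, and_true]
  refine ⟨?_, ?_, ?_⟩
  · funext v u
    exact hF v v.2 u u.2
  · ext v
    simp [hp v v.2]
  · ext v
    simp [hq v v.2]

/-- Extending the data by default values beyond the vertex set removes the dependent types, so that
encodings become statements about `List.range`. -/
theorem Instance.exists_eq_ofNat (A : Instance) :
    ∃ p q F, A = Instance.ofNat A.len A.n p q F := by
  obtain ⟨n, I, S, T, len⟩ := A
  refine ⟨fun i => if h : i < n then decide (⟨i, h⟩ ∈ S) else false,
    fun i => if h : i < n then decide (⟨i, h⟩ ∈ T) else false,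
    fun v u => if h : v < n then if h' : u < v then I ⟨v, h⟩ ⟨u, h'⟩ else [] else [], ?_⟩
  simp only [Instance.ofNat, Instance.mk.injEq, heq_eq_eq, true_and, and_true]
  refine ⟨?_, ?_, ?_⟩
  · funext v u
    simp
  · ext v
    simp
  · ext v
    simp

theorem charVector_filter (n : ℕ) (p : ℕ → Bool) :
    charVector (Finset.univ.filter fun v : Fin n => p v = true) = (List.range n).map p := by
  rw [charVector, ← List.map_coe_finRange_eq_range, List.map_map]
  refine List.map_congr_left fun v _ => ?_
  simp

theorem flatMap_finRange (n : ℕ) (f : ℕ → Word) :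
    (List.finRange n).flatMap (fun v : Fin n => f v) = (List.range n).flatMap f := by
  have : List.range n = (List.finRange n).map Fin.val := by simp
  rw [this, List.flatMap_map]

theorem Instance.encode_ofNat (len n : ℕ) (p q : ℕ → Bool) (F : ℕ → ℕ → Word) :
    (Instance.ofNat len n p q F).encode = field (Nat.bits len) ++ (field ((List.range n).map p) ++
      (field ((List.range n).map q) ++
        (List.range n).flatMap fun v => (List.range v).flatMap fun u => field (F v u))) := by
  simp only [Instance.encode, Instance.ofNat, charVector_filter, List.append_assoc]
  rw [← flatMap_finRange n fun v => (List.range v).flatMap fun u => field (F v u)]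
  simp only [fun v : ℕ => flatMap_finRange v fun u => field (F v u)]

theorem map_getD_range (w : Word) : (List.range w.length).map (fun i => w.getD i false) = w :=
  List.ext_getElem (by simp) (by simp +contextual)

theorem flatMap_tri (n : ℕ) (f : ℕ → Word) :
    (List.range n).flatMap (fun v => (List.range v).flatMap fun u => f (tri v + u)) =
      (List.range (tri n)).flatMap f := by
  induction n with
  | zero => rfl
  | succ n ih => simp [List.range_succ, ih, tri, List.range_add, List.flatMap_map]

/-- The number with the given binary digits. -/
def ofBits (b : Word) : ℕ := b.foldr Nat.bit 0

/-- `isBits` only looks at the last, most significant digit, so a low-order digit can be removed as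
long as another one remains. -/
theorem isBits_cons_cons (c d : Bool) (b : Word) : isBits (c :: d :: b) = isBits (d :: b) := rfl

theorem ofBits_pos {b : Word} (hb : isBits b = true) (hne : b ≠ []) : 0 < ofBits b := by
  induction b with
  | nil => exact absurd rfl hne
  | cons c b ih =>
    rcases b with _ | ⟨d, b⟩
    · cases c
      · simp [isBits] at hb
      · simp [ofBits]
    · have := ih (by rwa [isBits_cons_cons] at hb) (by simp)
      change 0 < Nat.bit c (ofBits (d :: b))
      rw [Nat.bit_val]
      omega

theorem bits_ofBits {b : Word} (hb : isBits b = true) : Nat.bits (ofBits b) = b := by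
  induction b with
  | nil => simp [ofBits]
  | cons c b ih =>
    rcases b with _ | ⟨d, b⟩
    · cases c
      · simp [isBits] at hb
      · simp [ofBits]
    · rw [isBits_cons_cons] at hb
      have := ofBits_pos hb (by simp)
      change Nat.bits (Nat.bit c (ofBits (d :: b))) = _
      rw [Nat.bits_append_bit _ _ (by omega), ih hb]

theorem ofBits_bits (m : ℕ) : ofBits (Nat.bits m) = m := by
  induction m using Nat.binaryRec' with
  | zero => simp [ofBits]
  | bit b m h ih =>
    rw [Nat.bits_append_bit _ _ h]
    change Nat.bit b (ofBits (Nat.bits m)) = _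
    rw [ih]

theorem isBits_bits (m : ℕ) : isBits (Nat.bits m) = true := by
  induction m using Nat.binaryRec' with
  | zero => simp [isBits]
  | bit b m h ih =>
    rw [Nat.bits_append_bit _ _ h]
    rcases hm : Nat.bits m with _ | ⟨d, w⟩
    · have : m = 0 := by rw [← ofBits_bits m, hm]; rfl
      simp [isBits, h this]
    · rw [isBits_cons_cons, ← hm]
      exact ih

/-- The instance that is encoded by the word `x`. -/
def instanceOf (x : Word) : Instance :=
  Instance.ofNat (ofBits (lenBits x)) (sBits x).length (fun i => (sBits x).getD i false)
    (fun i => (tBits x).getD i false) (fun v u => pairWord x (tri v + u))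

theorem encode_instanceOf {x : Word} (hx : isInstance x = true) : (instanceOf x).encode = x := by
  simp only [isInstance, Bool.and_eq_true, decide_eq_true_eq, List.replicate_inj] at hx
  obtain ⟨hb, ⟨hst, -⟩, hx⟩ := hx
  rw [instanceOf, Instance.encode_ofNat, bits_ofBits hb, map_getD_range, hst, map_getD_range,
    flatMap_tri _ fun i => field (pairWord x i), ← hst, hx]

theorem fieldHead_flatMap_field (l : List Word) (i : ℕ) (hi : i < l.length) :
    fieldHead (fieldTail^[i] (l.flatMap field)) = l[i] := by
  induction l generalizing i with
  | nil => simp at hi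
  | cons a l ih =>
    rw [List.flatMap_cons]
    rcases i with _ | i
    · exact fieldHead_field_append ..
    · rw [Function.iterate_succ_apply, fieldTail_field_append]
      exact ih i (by simpa using hi)

theorem length_pairs (n : ℕ) (F : ℕ → ℕ → Word) :
    ((List.range n).flatMap fun v => (List.range v).map (F v)).length = tri n := by
  induction n with
  | zero => rfl
  | succ n ih => simp [List.range_succ, tri] at *; omega

theorem getElem?_pairs {n v u : ℕ} (F : ℕ → ℕ → Word) (hv : v < n) (hu : u < v) :
    ((List.range n).flatMap fun v => (List.range v).map (F v))[tri v + u]? = some (F v u) := by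
  induction n with
  | zero => omega
  | succ n ih =>
    rw [List.range_succ, List.flatMap_append]
    obtain hv | rfl := Nat.lt_succ_iff_lt_or_eq.1 hv
    · have h := tri_mono (Nat.succ_le_of_lt hv)
      rw [List.getElem?_append_left, ih hv]
      rw [length_pairs]
      simp only [tri] at h
      omega
    · rw [List.getElem?_append_right (by rw [length_pairs]; omega), length_pairs]
      simp [hu]

/-- Together with `encode_instanceOf` this makes decoding and encoding mutually inverse between
accepted words and instances; in particular the encoding is injective. -/
theorem instanceOf_encode (A : Instance) :
    isInstance A.encode = true ∧ instanceOf A.encode = A := by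
  obtain ⟨p, q, F, hA⟩ := A.exists_eq_ofNat
  have h := Instance.encode_ofNat A.len A.n p q F
  rw [← hA] at h
  generalize A.encode = x at h
  have hl : lenBits x = Nat.bits A.len := by rw [lenBits, h, fieldHead_field_append]
  have hs : sBits x = (List.range A.n).map p := by
    rw [sBits, h, fieldTail_field_append, fieldHead_field_append]
  have ht : tBits x = (List.range A.n).map q := by
    rw [tBits, h, fieldTail_field_append, fieldTail_field_append, fieldHead_field_append]
  have hF : ∀ v < A.n, ∀ u < v, pairWord x (tri v + u) = F v u := by
    intro v hv u hu
    have hlist : fieldTail (fieldTail (fieldTail x)) =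
        ((List.range A.n).flatMap fun v => (List.range v).map (F v)).flatMap field := by
      rw [h, fieldTail_field_append, fieldTail_field_append, fieldTail_field_append]
      simp only [List.flatMap_assoc, List.flatMap_map]
    have hget := getElem?_pairs F hv hu
    obtain ⟨hlt, hget⟩ := List.getElem?_eq_some_iff.1 hget
    rw [pairWord, hlist, fieldHead_flatMap_field _ _ hlt, hget]
  refine ⟨?_, ?_⟩
  · simp only [isInstance, Bool.and_eq_true, decide_eq_true_eq, hl, isBits_bits, hs, ht,
      List.length_map, true_and]
    rw [List.length_range, ← flatMap_tri A.n fun i => field (pairWord x i)]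
    refine Eq.trans ?_ h.symm
    congr 3
    refine List.flatMap_congr fun v hv => List.flatMap_congr fun u hu => ?_
    rw [hF v (List.mem_range.1 hv) u (List.mem_range.1 hu)]
  · have hn : (sBits x).length = A.n := by simp [hs]
    conv_rhs => rw [hA]
    rw [instanceOf, hl, ofBits_bits, hn]
    refine Instance.ofNat_congr ?_ ?_ hF
    · intro i hi
      simp [hs, hi]
    · intro i hi
      simp [ht, hi]

theorem mem_discoveryVertexCoverReconfiguration_iff (x : Word) (k : ℕ) :
    (x, k) ∈ DiscoveryVertexCoverReconfiguration ↔
      isInstance x = true ∧ (instanceOf x).IsProper ∧ (instanceOf x).Reconfigurable k := by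
  constructor
  · rintro ⟨A, rfl, hA⟩
    obtain ⟨h, h'⟩ := instanceOf_encode A
    exact ⟨h, h'.symm ▸ hA⟩
  · rintro ⟨hx, h⟩
    exact ⟨instanceOf x, encode_instanceOf hx, h⟩

end OracleKernel

namespace OracleKernel
namespace Instance

/-! ### Minimal vertex covers and reconfiguration sequences -/

/-- A vertex of a cover with all neighbours in the cover can be removed. Conversely, an edge from
`v` to a vertex outside `C` forces `v` into every cover contained in `C`. -/
theorem minimal_isCover_iff (A : Instance) (C : Finset (Fin A.n)) :
    Minimal A.IsCover C ↔ A.IsCover C ∧ ∀ v ∈ C, ∃ u, A.graph.Adj v u ∧ u ∉ C := by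
  constructor
  · refine fun h => ⟨h.1, fun v hv => ?_⟩
    by_contra! hcon
    have : A.IsCover (C.erase v) := by
      intro a b hab
      have ha := h.1 hab
      by_cases h1 : a = v
      · subst h1
        exact Or.inr (by simpa using ⟨hcon b hab, hab.ne'⟩)
      by_cases h2 : b = v
      · subst h2
        exact Or.inl (by simpa using ⟨hcon a hab.symm, hab.ne⟩)
      simpa [h1, h2] using ha
    have := h.2 this (Finset.erase_subset v C) hv
    simp at this
  · rintro ⟨hC, h⟩
    refine ⟨hC, fun D hD hDC v hv => ?_⟩
    obtain ⟨u, huv, hu⟩ := h v hv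
    have := hD huv
    simp only [Finset.mem_coe] at this
    exact this.resolve_right fun h => hu (hDC h)

/-- A sequence is a walk, possibly with pauses, in the graph of covers of size at most `k`. It can
be replaced by a path, which has at most `2 ^ A.n` vertices, and then prolonged by repeating its
end. -/
theorem reconfigurable_of_reconfigurable (A : Instance) {k m : ℕ} (hm : 2 ^ A.n ≤ m)
    (h : A.Reconfigurable k) : { A with len := m }.Reconfigurable k := by
  classical
  obtain ⟨hlen, X, hS, hT, hX, hstep⟩ := h
  let W := {C : Finset (Fin A.n) // A.IsCover C ∧ C.card ≤ k}
  let G : SimpleGraph W :=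
    { Adj := fun C D => C ≠ D ∧ (symmDiff C.1 D.1).card ≤ 1
      symm := ⟨fun C D h => ⟨h.1.symm, by rw [symmDiff_comm]; exact h.2⟩⟩
      loopless := ⟨fun C h => h.1 rfl⟩ }
  have hreach : ∀ i (h1 : 1 ≤ i) (h2 : i ≤ A.len),
      G.Reachable ⟨X 1, hX 1 le_rfl hlen⟩ ⟨X i, hX i h1 h2⟩ := by
    intro i h1
    induction i, h1 using Nat.le_induction with
    | base => exact fun _ => SimpleGraph.Reachable.refl _
    | succ i h1 ih =>
      intro h2
      refine (ih (by omega)).trans ?_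
      -- Consecutive sets may be equal, whereas the graph `G` has no loops.
      by_cases heq : X i = X (i + 1)
      · simp only [heq]
        exact SimpleGraph.Reachable.refl _
      · exact SimpleGraph.Adj.reachable ⟨fun h => heq (congrArg Subtype.val h), hstep i h1 (by omega)⟩
  obtain ⟨p, hp⟩ := (hreach A.len hlen le_rfl).exists_isPath
  have hpl : p.length < 2 ^ A.n := by
    refine hp.length_lt.trans_le ((Fintype.card_subtype_le _).trans ?_)
    simp
  -- Sequences start at index `1` and walks at `0`. Beyond its length `getVert` stays at the end
  -- vertex, which provides the padding.
  refine ⟨by have := Nat.one_le_two_pow (n := A.n); exact this.trans hm,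
    fun i => (p.getVert (i - 1)).1, ?_, ?_, fun i _ _ => (p.getVert (i - 1)).2, ?_⟩
  · simp [hS]
  · simp only
    rw [SimpleGraph.Walk.getVert_of_length_le _ (by omega)]
    exact hT
  · intro i h1 h2
    simp only
    by_cases hi : i - 1 < p.length
    · have := p.adj_getVert_succ hi
      rw [show i - 1 + 1 = i + 1 - 1 by omega] at this
      exact this.2
    · rw [SimpleGraph.Walk.getVert_of_length_le _ (by omega),
        SimpleGraph.Walk.getVert_of_length_le _ (by omega)]
      simp

theorem reconfigurable_congr_len (A : Instance) {k m : ℕ} (hm : 2 ^ A.n ≤ m)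
    (hlen : 2 ^ A.n ≤ A.len) : { A with len := m }.Reconfigurable k ↔ A.Reconfigurable k :=
  ⟨fun h => reconfigurable_of_reconfigurable { A with len := m } hlen h,
    A.reconfigurable_of_reconfigurable hm⟩

/-! ### Restricting an instance to a set of kept vertices. -/

section Restriction

variable {A B : Instance} {e : Fin B.n → Fin A.n} {k : ℕ}

theorem card_le_of_subset_preimage (he : Function.Injective e) {C : Finset (Fin B.n)}
    {D : Finset (Fin A.n)} (h : ∀ i ∈ C, e i ∈ D) : C.card ≤ D.card :=
  Finset.card_le_card_of_injOn e h he.injOn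

/-- The conditions under which the restriction of the instance `A` to the vertices in the range of
`e` is equivalent to `A`. -/
structure IsRestriction (A B : Instance) (e : Fin B.n → Fin A.n) (k : ℕ) : Prop where
  injective : Function.Injective e
  adj : ∀ i j, B.graph.Adj i j ↔ A.graph.Adj (e i) (e j)
  mem_S : ∀ i, i ∈ B.S ↔ e i ∈ A.S
  mem_T : ∀ i, i ∈ B.T ↔ e i ∈ A.T
  S_range : ∀ v ∈ A.S, v ∈ Set.range e
  T_range : ∀ v ∈ A.T, v ∈ Set.range e
  card_S : A.S.card ≤ k
  card_T : A.T.card ≤ k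
  nbrs : ∀ v ∈ A.S ∪ A.T, ∀ u, A.graph.Adj v u → u ∉ Set.range e →
    ∃ N : Finset (Fin B.n), k < N.card ∧ ∀ i ∈ N, A.graph.Adj v (e i)

/-- The neighbour outside `C` that makes a vertex indispensable may have been dropped. Then more
than `k` kept neighbours exist, and `C`, of size at most `k`, misses one of them. -/
theorem IsRestriction.minimal (h : IsRestriction A B e k) {C : Finset (Fin A.n)}
    {D : Finset (Fin B.n)} (hD : ∀ i, i ∈ D ↔ e i ∈ C) (hC : Minimal A.IsCover C)
    (hsub : C ⊆ A.S ∪ A.T) (hk : C.card ≤ k) : Minimal B.IsCover D := by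
  rw [minimal_isCover_iff] at hC ⊢
  refine ⟨fun i j hij => ?_, fun i hi => ?_⟩
  · have := hC.1 ((h.adj i j).1 hij)
    simpa [hD] using this
  · obtain ⟨u, hu, huC⟩ := hC.2 (e i) ((hD i).1 hi)
    by_cases hur : u ∈ Set.range e
    · obtain ⟨j, rfl⟩ := hur
      exact ⟨j, (h.adj i j).2 hu, fun hj => huC ((hD j).1 hj)⟩
    · obtain ⟨N, hN, hNadj⟩ := h.nbrs (e i) (hsub ((hD i).1 hi)) u hu hur
      by_contra! hcon
      have := card_le_of_subset_preimage (D := C) h.injective (C := N) fun j hj =>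
        (hD j).1 (hcon j ((h.adj i j).2 (hNadj j hj)))
      omega

theorem IsRestriction.isProper (h : IsRestriction A B e k) (hA : A.IsProper) : B.IsProper :=
  ⟨h.minimal h.mem_S hA.1 Finset.subset_union_left h.card_S,
    h.minimal h.mem_T hA.2 Finset.subset_union_right h.card_T⟩

/-- An edge leaving the kept vertices starts in `A.S`, at a vertex with more than `k` kept
neighbours. A cover avoiding this vertex would contain all those neighbours and be too large. -/
theorem IsRestriction.isCover_map (h : IsRestriction A B e k) (hA : A.IsCover A.S)
    {D : Finset (Fin B.n)} (hD : B.IsCover D) (hk : D.card ≤ k) :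
    A.IsCover (D.map ⟨e, h.injective⟩) := by
  have key : ∀ u v, A.graph.Adj v u → u ∉ Set.range e → v ∈ D.map ⟨e, h.injective⟩ := by
    intro u v huv hu
    have hv : v ∈ A.S := by
      have := hA huv
      simp only [Finset.mem_coe] at this
      exact this.resolve_right fun h' => hu (h.S_range u h')
    obtain ⟨i, rfl⟩ := h.S_range v hv
    obtain ⟨N, hN, hNadj⟩ := h.nbrs (e i) (Finset.mem_union_left _ hv) u huv hu
    rw [Finset.mem_map]
    refine ⟨i, ?_, rfl⟩
    by_contra hi
    have : N ⊆ D := fun j hj => by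
      have := hD ((h.adj i j).2 (hNadj j hj))
      simp only [Finset.mem_coe] at this
      exact this.resolve_left hi
    have := Finset.card_le_card this
    omega
  intro v u hvu
  by_cases hu : u ∈ Set.range e
  · by_cases hv : v ∈ Set.range e
    · obtain ⟨i, rfl⟩ := hu
      obtain ⟨j, rfl⟩ := hv
      have := hD ((h.adj j i).2 hvu)
      simpa [h.injective.eq_iff] using this
    · exact Or.inr (key v u hvu.symm hv)
  · exact Or.inl (key u v hvu hu)

/-- Sequences of `B` are pushed forward along `e`, which preserves covers by `isCover_map`;
sequences of `A` are pulled back, which enlarges neither the sets nor their differences. The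
endpoints match since `S` and `T` lie in the range of `e`. -/
theorem IsRestriction.reconfigurable_iff (h : IsRestriction A B e k) (hA : A.IsProper)
    (hlen : B.len = A.len) : B.Reconfigurable k ↔ A.Reconfigurable k := by
  classical
  rw [Reconfigurable, Reconfigurable, hlen]
  refine and_congr_right fun _ => ⟨?_, ?_⟩
  · rintro ⟨X, hS, hT, hX, hstep⟩
    refine ⟨fun i => (X i).map ⟨e, h.injective⟩, ?_, ?_, fun i h1 h2 => ⟨h.isCover_map hA.1.1
      (hX i h1 h2).1 (hX i h1 h2).2, by simpa using (hX i h1 h2).2⟩, fun i h1 h2 => ?_⟩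
    · ext v
      simp only [hS, Finset.mem_map, Function.Embedding.coeFn_mk, h.mem_S]
      exact ⟨by rintro ⟨i, hi, rfl⟩; exact hi, fun hv => by
        obtain ⟨i, rfl⟩ := h.S_range v hv; exact ⟨i, hv, rfl⟩⟩
    · ext v
      simp only [hT, Finset.mem_map, Function.Embedding.coeFn_mk, h.mem_T]
      exact ⟨by rintro ⟨i, hi, rfl⟩; exact hi, fun hv => by
        obtain ⟨i, rfl⟩ := h.T_range v hv; exact ⟨i, hv, rfl⟩⟩
    · have : symmDiff ((X i).map ⟨e, h.injective⟩) ((X (i + 1)).map ⟨e, h.injective⟩) =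
          (symmDiff (X i) (X (i + 1))).map ⟨e, h.injective⟩ := by
        simp only [Finset.map_eq_image]
        exact (Finset.image_symmDiff _ _ h.injective).symm
      simp only
      rw [this, Finset.card_map]
      exact hstep i h1 h2
  · rintro ⟨X, hS, hT, hX, hstep⟩
    refine ⟨fun i => Finset.univ.filter fun j => e j ∈ X i, ?_, ?_, fun i h1 h2 => ⟨?_, ?_⟩,
      fun i h1 h2 => ?_⟩
    · ext j
      simp [hS, h.mem_S]
    · ext j
      simp [hT, h.mem_T]
    · intro a b hab
      have := (hX i h1 h2).1 ((h.adj a b).1 hab)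
      simpa using this
    · exact (card_le_of_subset_preimage h.injective (by simp)).trans (hX i h1 h2).2
    · refine (card_le_of_subset_preimage h.injective ?_).trans (hstep i h1 h2)
      simp [Finset.mem_symmDiff]

end Restriction

end Instance
end OracleKernel

namespace OracleKernel

open Instance (field)

/-! ### Constant yes- and no-instances of SAT. -/

theorem nil_mem_SAT : [] ∈ SAT := ⟨[], rfl, fun _ => false, by simp⟩

/-- The end mark of a clause alone takes two bits, so no formula has an encoding of length one. -/
theorem singleton_notMem_SAT : [true] ∉ SAT := by
  rintro ⟨φ, h, -⟩
  have := congrArg List.length h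
  rcases φ with _ | ⟨c, φ⟩
  · simp [encodeCNF] at this
  · simp [encodeCNF, encodeClause] at this
    omega

/-! ### Counting -/

theorem countP_range (P : ℕ → Bool) (n : ℕ) :
    (List.range n).countP P = Nat.count (fun i => P i = true) n := by
  induction n with
  | zero => simp
  | succ n ih => simp [List.range_succ, Nat.count_succ, ih, List.countP_singleton]

theorem count_bound {p : ℕ → Prop} [DecidablePred p] {n i : ℕ} (hi : i < Nat.count p n)
    (hf : (Set.ofPred p).Finite) : i < hf.toFinset.card :=
  hi.trans_le (Nat.count_le_card hf n)

theorem count_nth_of_lt_count {p : ℕ → Prop} [DecidablePred p] {n i : ℕ} (hi : i < Nat.count p n) :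
    Nat.count p (Nat.nth p i) = i :=
  Nat.count_nth fun hf => count_bound hi hf

theorem nth_mem_of_lt_count {p : ℕ → Prop} [DecidablePred p] {n i : ℕ} (hi : i < Nat.count p n) :
    p (Nat.nth p i) :=
  Nat.nth_mem _ fun hf => count_bound hi hf

/-- The elements that satisfy `P`, in increasing order. -/
noncomputable def enum (P : ℕ → Bool) (i : ℕ) : ℕ := Nat.nth (fun i => P i = true) i

section Enum

variable {P : ℕ → Bool} {n i : ℕ}

theorem enum_lt (hi : i < (List.range n).countP P) : enum P i < n := by
  rw [countP_range] at hi
  exact Nat.nth_lt_of_lt_count hi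

theorem enum_mem (hi : i < (List.range n).countP P) : P (enum P i) = true := by
  rw [countP_range] at hi
  exact nth_mem_of_lt_count hi

theorem countP_enum (hi : i < (List.range n).countP P) :
    (List.range (enum P i)).countP P = i := by
  rw [countP_range] at hi ⊢
  exact count_nth_of_lt_count hi

theorem enum_countP (hn : P n = true) : enum P ((List.range n).countP P) = n := by
  rw [countP_range]
  exact Nat.nth_count (p := fun i => P i = true) hn

theorem countP_lt_countP (hi : P i = true) (hin : i < n) :
    (List.range i).countP P < (List.range n).countP P := by
  rw [countP_range, countP_range]
  exact Nat.count_strict_mono hi hin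

/-- Skipping the dropped vertices amounts to renumbering the kept ones. This identifies the kernel
word with the encoding of an instance on the kept vertices. -/
theorem flatMap_bif (P : ℕ → Bool) (n : ℕ) (g : ℕ → Word) :
    ((List.range n).flatMap fun v => bif P v then g v else []) =
      (List.range ((List.range n).countP P)).flatMap fun i => g (enum P i) := by
  induction n with
  | zero => rfl
  | succ n ih =>
    rw [List.range_succ, List.flatMap_append, ih, List.countP_append, List.flatMap_singleton]
    cases h : P n
    · simp [h]
    · simp [h, List.range_succ, enum_countP h]

theorem restrict_eq (P : ℕ → Bool) (n : ℕ) (s : Word) : restrict P n s =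
    (List.range ((List.range n).countP P)).map fun i => s.getD (enum P i) false := by
  rw [restrict, flatMap_bif P n fun i => [s.getD i false], List.map_eq_flatMap]

theorem kernelPairs_eq (P : ℕ → Bool) (n : ℕ) (e : Word) : kernelPairs P n e =
    (List.range ((List.range n).countP P)).flatMap fun v => (List.range v).flatMap fun u =>
      field (bif edge e (enum P v) (enum P u) then [] else [true]) := by
  rw [kernelPairs, flatMap_bif P n fun v => (List.range v).flatMap fun u => bif P u then
      field (bif edge e v u then [] else [true]) else []]
  refine List.flatMap_congr fun i hi => ?_
  rw [List.mem_range] at hi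
  rw [flatMap_bif P (enum P i) fun u => field (bif edge e (enum P i) u then [] else [true]),
    countP_enum hi]

end Enum

/-! ### The discovered graph -/

theorem getD_edgeBits {x : Word} {i : ℕ} (hi : i < tri (sBits x).length) :
    (edgeBits x).getD i false = true ↔ pairWord x i ∈ SAT := by
  classical
  rw [edgeBits, ← List.map_eq_flatMap]
  simp [hi]

theorem edge_comm (e : Word) (i j : ℕ) : edge e i j = edge e j i := by
  unfold edge
  by_cases h : i < j
  · simp [h, h.not_gt]
  · by_cases h' : j < i <;> simp [h, h']

theorem adj_instanceOf (x : Word) (i j : Fin (instanceOf x).n) :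
    (instanceOf x).graph.Adj i j ↔ edge (edgeBits x) i j = true := by
  have key : ∀ i j : Fin (instanceOf x).n, i < j → ((instanceOf x).graph.Adj i j ↔
      edge (edgeBits x) i j = true) := by
    intro i j hij
    have hij' : i.val < j.val := hij
    have hlt : tri j + i < tri (sBits x).length := by
      have : tri (j.val + 1) ≤ tri (sBits x).length := tri_mono j.2
      rw [tri] at this
      omega
    have : edge (edgeBits x) i j = (edgeBits x).getD (tri j + i) false := by simp [edge, hij']
    rw [this, getD_edgeBits hlt, Instance.graph, SimpleGraph.fromRel_adj]
    exact ⟨fun h => h.2.elim (fun h => h.2) fun h => absurd h.1 hij.not_gt,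
      fun h => ⟨hij.ne, Or.inl ⟨hij, h⟩⟩⟩
  rcases lt_trichotomy i j with h | rfl | h
  · exact key i j h
  · simp [edge]
  · rw [SimpleGraph.adj_comm, edge_comm]
    exact key j i h

theorem isCoverWord_iff {A : Instance} {e s : Word} {C : Finset (Fin A.n)}
    (hadj : ∀ i j, A.graph.Adj i j ↔ edge e i j = true)
    (hs : ∀ i : Fin A.n, i ∈ C ↔ s.getD i false = true) :
    isCoverWord e A.n s = true ↔ A.IsCover C := by
  simp only [isCoverWord, List.all_eq_true, List.mem_range, Bool.or_eq_true, Bool.not_eq_true']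
  constructor
  · intro h i j hij
    have := h i i.2 j j.2
    rw [(hadj i j).1 hij] at this
    simpa [hs] using this
  · intro h i hi j hj
    by_cases hij : edge e i j = true
    · have := h ((hadj ⟨i, hi⟩ ⟨j, hj⟩).2 hij)
      simp only [Finset.mem_coe, hs] at this
      exact Or.inr this
    · exact Or.inl (by simpa using hij)

theorem isMinCover_iff {A : Instance} {e s : Word} {C : Finset (Fin A.n)}
    (hadj : ∀ i j, A.graph.Adj i j ↔ edge e i j = true)
    (hs : ∀ i : Fin A.n, i ∈ C ↔ s.getD i false = true) :
    isMinCover e A.n s = true ↔ Minimal A.IsCover C := by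
  rw [Instance.minimal_isCover_iff, isMinCover, Bool.and_eq_true]
  refine and_congr (isCoverWord_iff hadj hs) ?_
  · simp only [List.all_eq_true, List.any_eq_true, List.mem_range, Bool.or_eq_true,
      Bool.not_eq_true', Bool.and_eq_true]
    constructor
    · intro h i hi
      obtain h | ⟨j, hj, hij, hjs⟩ := h i i.2
      · exact absurd (h.symm.trans ((hs i).1 hi)) Bool.false_ne_true
      · exact ⟨⟨j, hj⟩, (hadj i ⟨j, hj⟩).2 hij, fun hj' =>
          absurd (hjs.symm.trans ((hs ⟨j, hj⟩).1 hj')) Bool.false_ne_true⟩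
    · intro h i hi
      by_cases his : s.getD i false = true
      · obtain ⟨j, hij, hj⟩ := h ⟨i, hi⟩ ((hs ⟨i, hi⟩).2 his)
        exact Or.inr ⟨j, j.2, (hadj _ _).1 hij, by simpa [hs] using hj⟩
      · exact Or.inl (by simpa using his)

theorem card_eq_countP {n : ℕ} {s : Word} {C : Finset (Fin n)}
    (hs : ∀ i : Fin n, i ∈ C ↔ s.getD i false = true) :
    C.card = (List.range n).countP fun i => s.getD i false := by
  rw [countP_range, Nat.count_eq_card_filter_range, ← Finset.card_map Fin.valEmbedding]
  congr 1
  ext i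
  simp only [Finset.mem_map, hs, Fin.valEmbedding_apply, Finset.mem_filter, Finset.mem_range]
  exact ⟨by rintro ⟨j, hj, rfl⟩; exact ⟨j.2, hj⟩, fun h => ⟨⟨i, h.1⟩, h.2, rfl⟩⟩

theorem mem_S_instanceOf {x : Word} (i : Fin (instanceOf x).n) :
    i ∈ (instanceOf x).S ↔ (sBits x).getD i false = true :=
  Finset.mem_filter_univ i

theorem mem_T_instanceOf {x : Word} (i : Fin (instanceOf x).n) :
    i ∈ (instanceOf x).T ↔ (tBits x).getD i false = true :=
  Finset.mem_filter_univ i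

theorem isGood_iff (x : Word) (k : ℕ) :
    isGood (edgeBits x) (sBits x).length (sBits x) (tBits x) k = true ↔
      (instanceOf x).IsProper ∧ (instanceOf x).S.card ≤ k ∧ (instanceOf x).T.card ≤ k := by
  simp only [isGood, Bool.and_eq_true, sizeLE, decide_eq_true_eq, Instance.IsProper]
  rw [← isMinCover_iff (adj_instanceOf x) mem_S_instanceOf,
    ← isMinCover_iff (adj_instanceOf x) mem_T_instanceOf, card_eq_countP mem_S_instanceOf,
    card_eq_countP mem_T_instanceOf, and_assoc]
  rfl

/-! ### Correctness of the kernelization -/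

/-- If the neighbour `u` of `v` is dropped, more than `k` neighbours of `v` precede it. The first `k
+ 1` of them each have at most `k` predecessors among the neighbours of `v` and are therefore kept.
-/
theorem exists_kept_neighbours {e s t : Word} {n k u v : ℕ} (hv : v < n) (hu : u < n)
    (hvst : inUnion s t v = true) (hvu : edge e v u = true) (hk : keep e n s t k u = false) :
    ∃ M : Finset ℕ, M.card = k + 1 ∧
      ∀ w ∈ M, w < n ∧ edge e v w = true ∧ keep e n s t k w = true := by
  have hcount : k < (List.range u).countP (edge e v) := by
    by_contra! h
    simp only [keep, Bool.or_eq_false_iff, List.any_eq_false, List.mem_range] at hk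
    refine hk.2 v hv ?_
    simpa [hvst, hvu] using h
  refine ⟨(Finset.range (k + 1)).image (enum (edge e v)), ?_, ?_⟩
  · rw [Finset.card_image_of_injOn, Finset.card_range]
    intro i hi j hj hij
    simp only [Finset.coe_range, Set.mem_Iio] at hi hj
    rw [← countP_enum (P := edge e v) (n := u) (i := i) (by omega), hij,
      countP_enum (n := u) (by omega)]
  · intro w hw
    obtain ⟨i, hi, rfl⟩ := Finset.mem_image.1 hw
    rw [Finset.mem_range] at hi
    have hi' : i < (List.range u).countP (edge e v) := by omega
    have h1 := enum_lt hi'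
    have h2 := enum_mem hi'
    have h3 := countP_enum hi'
    refine ⟨h1.trans hu, h2, ?_⟩
    simp only [keep, Bool.or_eq_true, List.any_eq_true, List.mem_range, Bool.and_eq_true,
      decide_eq_true_eq]
    exact Or.inr ⟨v, hv, hvst, h2, h3.le.trans (by omega)⟩

/-- The subinstance on the vertices that satisfy `P`, for sequences of length `len`. -/
noncomputable def subinstance (P : ℕ → Bool) (n : ℕ) (e s t : Word) (len : ℕ) : Instance :=
  Instance.ofNat len ((List.range n).countP P) (fun i => s.getD (enum P i) false)
    (fun i => t.getD (enum P i) false)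
    (fun v u => bif edge e (enum P v) (enum P u) then [] else [true])

theorem adj_subinstance {P : ℕ → Bool} {n : ℕ} {e s t : Word} {len : ℕ}
    (i j : Fin (subinstance P n e s t len).n) :
    (subinstance P n e s t len).graph.Adj i j ↔ edge e (enum P i) (enum P j) = true := by
  have key : ∀ a b, (bif edge e a b then [] else [true]) ∈ SAT ↔ edge e a b = true := by
    intro a b
    cases edge e a b
    · simpa using singleton_notMem_SAT
    · simpa using nil_mem_SAT
  rw [Instance.graph, SimpleGraph.fromRel_adj]
  simp only [subinstance, Instance.ofNat, key]
  rw [edge_comm e (enum P j), exists_prop, exists_prop, ← or_and_right]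
  constructor
  · exact fun h => h.2.2
  · intro h
    have : i ≠ j := by
      rintro rfl
      simp [edge] at h
    exact ⟨this, this.lt_or_gt, h⟩

theorem isRestriction_subinstance {x : Word} {k : ℕ}
    (hS : (instanceOf x).S.card ≤ k) (hT : (instanceOf x).T.card ≤ k) {P : ℕ → Bool}
    (hP : P = keep (edgeBits x) (sBits x).length (sBits x) (tBits x) k) :
    Instance.IsRestriction (instanceOf x)
      (subinstance P (sBits x).length (edgeBits x) (sBits x) (tBits x) (instanceOf x).len)
      (fun i => ⟨enum P i, enum_lt i.2⟩) k where
  injective i j hij := by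
    have : enum P i = enum P j := congrArg Fin.val hij
    ext
    rw [← countP_enum i.2, this, countP_enum j.2]
  adj i j := by rw [adj_subinstance, adj_instanceOf]
  mem_S i := by
    rw [mem_S_instanceOf]
    exact Finset.mem_filter_univ i
  mem_T i := by
    rw [mem_T_instanceOf]
    exact Finset.mem_filter_univ i
  S_range v hv := by
    have : P v = true := by
      rw [mem_S_instanceOf] at hv
      simp only [hP, keep, inUnion, hv, Bool.true_or]
    exact ⟨⟨_, countP_lt_countP this v.2⟩, Fin.ext (enum_countP this)⟩
  T_range v hv := by
    have : P v = true := by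
      rw [mem_T_instanceOf] at hv
      simp only [hP, keep, inUnion, hv, Bool.true_or, Bool.or_true]
    exact ⟨⟨_, countP_lt_countP this v.2⟩, Fin.ext (enum_countP this)⟩
  card_S := hS
  card_T := hT
  nbrs v hv u hvu hu := by
    have hu' : P u = false := by
      by_contra h
      rw [Bool.not_eq_false] at h
      exact hu ⟨⟨_, countP_lt_countP h u.2⟩, Fin.ext (enum_countP h)⟩
    have hv' : inUnion (sBits x) (tBits x) v = true := by
      rw [Finset.mem_union, mem_S_instanceOf, mem_T_instanceOf] at hv
      simpa [inUnion] using hv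
    rw [adj_instanceOf] at hvu
    obtain ⟨M, hM, hMw⟩ :=
      exists_kept_neighbours (n := (sBits x).length) v.2 u.2 hv' hvu (hP ▸ hu')
    rw [← hP] at hMw
    refine ⟨Finset.univ.filter fun i => enum P i ∈ M, ?_, fun i hi => ?_⟩
    · have : M ⊆ (Finset.univ.filter fun i : Fin (subinstance P (sBits x).length (edgeBits x)
          (sBits x) (tBits x) (instanceOf x).len).n => enum P i ∈ M).image fun i : Fin _ => enum P i := by
        intro w hw
        obtain ⟨h1, h2, h3⟩ := hMw w hw
        refine Finset.mem_image.2 ⟨⟨_, countP_lt_countP h3 h1⟩, ?_, enum_countP h3⟩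
        simpa [enum_countP h3] using hw
      have := (Finset.card_le_card this).trans Finset.card_image_le
      omega
    · rw [adj_instanceOf]
      exact (hMw _ (Finset.mem_filter.1 hi).2).2.1

theorem isBits_replicate (m : ℕ) : isBits (List.replicate m true) = true := by
  induction m with
  | zero => rfl
  | succ m ih =>
    cases m
    · rfl
    · exact ih

theorem isBits_capBits {b : Word} (hb : isBits b = true) (m : ℕ) :
    isBits (capBits m b) = true := by
  unfold capBits
  by_cases h : b.length ≤ m
  · simpa [h] using hb
  · simpa [h] using isBits_replicate m

/-- The most significant digit is `1` and stands at position `m` or higher. -/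
theorem two_pow_le_ofBits {b : Word} {m : ℕ} (hb : isBits b = true) (h : m < b.length) :
    2 ^ m ≤ ofBits b := by
  induction b generalizing m with
  | nil => simp at h
  | cons c b ih =>
    rcases m with _ | m
    · exact ofBits_pos hb (by simp)
    · rcases b with _ | ⟨d, b⟩
      · simp at h
      · have := ih (by rwa [isBits_cons_cons] at hb) (m := m) (by simpa using h)
        change _ ≤ Nat.bit c (ofBits (d :: b))
        rw [Nat.bit_val, pow_succ]
        omega

theorem encode_subinstance {P : ℕ → Bool} {n : ℕ} {e s t b : Word} (hb : isBits b = true) :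
    (subinstance P n e s t (ofBits b)).encode =
      field b ++ (field (restrict P n s) ++ (field (restrict P n t) ++ kernelPairs P n e)) := by
  rw [subinstance, Instance.encode_ofNat, bits_ofBits hb, restrict_eq, restrict_eq, kernelPairs_eq]

theorem isBits_lenBits {x : Word} (hx : isInstance x = true) : isBits (lenBits x) = true := by
  simp only [isInstance, Bool.and_eq_true] at hx
  exact hx.1

theorem mem_iff_of_encode {A : Instance} {x : Word} (h : A.encode = x) (k : ℕ) :
    (x, k) ∈ DiscoveryVertexCoverReconfiguration ↔ A.IsProper ∧ A.Reconfigurable k := by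
  obtain ⟨h1, h2⟩ := instanceOf_encode A
  rw [mem_discoveryVertexCoverReconfiguration_iff, ← h, h1, h2]
  simp

theorem nil_notMem (k : ℕ) : ([], k) ∉ DiscoveryVertexCoverReconfiguration := by
  rw [mem_discoveryVertexCoverReconfiguration_iff]
  rintro ⟨h, -⟩
  exact absurd h (by decide)

theorem kernel_mem_iff (x : Word) (k : ℕ) :
    (kernel x k, k) ∈ DiscoveryVertexCoverReconfiguration ↔
      (x, k) ∈ DiscoveryVertexCoverReconfiguration := by
  unfold kernel
  by_cases h : (isInstance x &&
    isGood (edgeBits x) (sBits x).length (sBits x) (tBits x) k) = true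
  · rw [h, cond_true]
    rw [Bool.and_eq_true, isGood_iff] at h
    obtain ⟨hx, hproper, hS, hT⟩ := h
    rw [kernelWord]
    generalize hP : keep (edgeBits x) (sBits x).length (sBits x) (tBits x) k = P
    have hres := isRestriction_subinstance hS hT hP.symm
    generalize hm : (List.range (sBits x).length).countP P = m
    have hb := isBits_lenBits hx
    rw [mem_iff_of_encode (encode_subinstance (isBits_capBits hb (m + 1))),
      mem_iff_of_encode (encode_instanceOf hx), ← hres.reconfigurable_iff hproper rfl]
    have hproper' := hres.isProper hproper
    set B := subinstance P (sBits x).length (edgeBits x) (sBits x) (tBits x) (instanceOf x).len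
      with hB
    have hsub : subinstance P (sBits x).length (edgeBits x) (sBits x) (tBits x)
      (ofBits (capBits (m + 1) (lenBits x))) =
        { B with len := ofBits (capBits (m + 1) (lenBits x)) } := rfl
    rw [hsub]
    refine and_congr (iff_of_true hproper' hproper) ?_
    by_cases hlen : (lenBits x).length ≤ m + 1
    · rw [capBits, decide_eq_true hlen, cond_true]
      exact Iff.rfl
    · have hBn : B.n = m := hm
      -- Both lengths are at least `2 ^ m`: the capped one consists of `m + 1` ones, and the
      -- original one has more than `m + 1` digits.
      refine Instance.reconfigurable_congr_len B ?_ ?_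
      · rw [hBn, capBits, decide_eq_false hlen, cond_false]
        exact two_pow_le_ofBits (isBits_replicate _) (by simp)
      · rw [hBn]
        exact two_pow_le_ofBits hb (by omega)
  · rw [Bool.eq_false_iff.2 h, cond_false]
    -- A yes-instance passes the test, since `S` and `T` occur in its sequence and so obey the size
    -- bound.
    refine iff_of_false (nil_notMem k) fun hmem => h ?_
    rw [mem_discoveryVertexCoverReconfiguration_iff] at hmem
    obtain ⟨hx, hproper, hlen, X, h1, h2, hX, -⟩ := hmem
    rw [Bool.and_eq_true, isGood_iff]
    refine ⟨hx, hproper, ?_, ?_⟩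
    · rw [← h1]
      exact (hX 1 le_rfl hlen).2
    · rw [← h2]
      exact (hX _ hlen le_rfl).2

/-! ### The size of the kernel -/

/-- The union of the two covers has at most `2 * k` vertices, and each of them contributes at most
`k + 1` neighbours. -/
theorem countP_keep_le {e s t : Word} {n k : ℕ} (hs : sizeLE n s k = true)
    (ht : sizeLE n t k = true) :
    (List.range n).countP (keep e n s t k) ≤ 2 * k + 2 * k * (k + 1) := by
  simp only [sizeLE, decide_eq_true_eq, countP_range, Nat.count_eq_card_filter_range] at hs ht
  rw [countP_range, Nat.count_eq_card_filter_range]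
  set U := (Finset.range n).filter fun i => inUnion s t i = true with hU
  have hUcard : U.card ≤ 2 * k := by
    refine (Finset.card_le_card (t := (Finset.range n).filter (fun i => s.getD i false = true) ∪
      (Finset.range n).filter (fun i => t.getD i false = true)) ?_).trans
      ((Finset.card_union_le _ _).trans (by omega))
    intro i
    simp only [hU, inUnion, Finset.mem_filter, Finset.mem_union, Bool.or_eq_true]
    tauto
  let N : ℕ → Finset ℕ := fun v => (Finset.range n).filter fun w =>
    edge e v w = true ∧ (List.range w).countP (edge e v) ≤ k
  have hN : ∀ v ∈ U, (N v).card ≤ k + 1 := by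
    intro v _
    rw [← Finset.card_range (k + 1)]
    -- A neighbour of `v` is determined by its rank among the neighbours of `v`, here a number from
    -- `0` to `k`.
    refine Finset.card_le_card_of_injOn (fun w => (List.range w).countP (edge e v)) ?_ ?_
    · intro w hw
      have := (Finset.mem_filter.1 (Finset.mem_coe.1 hw)).2.2
      simp only [Finset.coe_range, Set.mem_Iio]
      omega
    · intro w hw w' hw' hww
      have h1 := (Finset.mem_filter.1 (Finset.mem_coe.1 hw)).2.1
      have h2 := (Finset.mem_filter.1 (Finset.mem_coe.1 hw')).2.1
      simp only at hww
      rw [← enum_countP h1, hww, enum_countP h2]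
  have hsub : ((Finset.range n).filter fun i => keep e n s t k i = true) ⊆ U ∪ U.biUnion N := by
    intro w hw
    simp only [Finset.mem_filter, Finset.mem_range, keep, Bool.or_eq_true, List.any_eq_true,
      List.mem_range, Bool.and_eq_true, decide_eq_true_eq] at hw
    obtain ⟨hwn, h | ⟨v, hv, h1, h2, h3⟩⟩ := hw
    · exact Finset.mem_union_left _ (by simp [hU, hwn, h])
    · exact Finset.mem_union_right _ (Finset.mem_biUnion.2
        ⟨v, by simp [hU, hv, h1], by simp [N, hwn, h2, h3]⟩)
  refine (Finset.card_le_card hsub).trans ((Finset.card_union_le _ _).trans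
    (add_le_add hUcard ((Finset.card_biUnion_le_card_mul _ _ _ hN).trans
      (Nat.mul_le_mul_right _ hUcard))))

theorem length_flatMap_range_le {m c : ℕ} {f : ℕ → Word} (h : ∀ i < m, (f i).length ≤ c) :
    ((List.range m).flatMap f).length ≤ m * c := by
  have := List.sum_le_card_nsmul ((List.range m).map fun i => (f i).length) c (by
    simpa using h)
  simpa [List.length_flatMap] using this

/-- The summands bound the capped length, the two characteristic vectors, and fewer than `N * N`
pair fields of at most three symbols each, where a field doubles a word and adds one symbol. -/
theorem length_kernel_le (x : Word) (k : ℕ) {N : ℕ} (hN : N = 2 * k + 2 * k * (k + 1)) :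
    (kernel x k).length ≤ (2 * (N + 1) + 1) + ((2 * N + 1) + ((2 * N + 1) + N * (N * 3))) := by
  unfold kernel
  cases h : isInstance x && isGood (edgeBits x) (sBits x).length (sBits x) (tBits x) k
  · simp
  · rw [cond_true, kernelWord]
    simp only [isGood, Bool.and_eq_true] at h
    have hle := countP_keep_le (e := edgeBits x) h.2.2.2.1 h.2.2.2.2
    rw [← hN] at hle
    simp only [List.length_append, length_field, restrict_eq, kernelPairs_eq, List.length_map,
      List.length_range]
    generalize hP : keep (edgeBits x) (sBits x).length (sBits x) (tBits x) k = P at hle ⊢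
    generalize (List.range (sBits x).length).countP P = m at hle ⊢
    have hcap : (capBits (m + 1) (lenBits x)).length ≤ m + 1 := by
      unfold capBits
      by_cases h : (lenBits x).length ≤ m + 1
      · simpa only [decide_eq_true h, cond_true] using h
      · simp [h]
    refine add_le_add (by omega) (add_le_add (by omega) (add_le_add (by omega) ?_))
    refine (length_flatMap_range_le (c := N * 3) fun v hv => ?_).trans (Nat.mul_le_mul_right _ hle)
    refine (length_flatMap_range_le (c := 3) fun u _ => ?_).trans (Nat.mul_le_mul_right _ (by omega))
    rw [length_field]
    cases edge (edgeBits x) (enum P v) (enum P u) <;> simp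

theorem exists_polynomial_kernel_le : ∃ q : Polynomial ℕ, ∀ (x : Word) (k : ℕ),
    (kernel x k).length + k ≤ q.eval k := by
  let N : Polynomial ℕ := 2 * .X + 2 * .X * (.X + 1)
  refine ⟨(2 * (N + 1) + 1) + ((2 * N + 1) + ((2 * N + 1) + N * (N * 3))) + .X, fun x k => ?_⟩
  have := length_kernel_le x k (N := N.eval k) (by simp [N])
  simp only [Polynomial.eval_add, Polynomial.eval_mul, Polynomial.eval_one, Polynomial.eval_ofNat,
    Polynomial.eval_X]
  omega

end OracleKernel

namespace OracleKernel

open Instance (field charVector)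

/-! ### Primitive recursive functions on lists -/

section Primrec

variable {α β σ : Type*} [Primcodable α] [Primcodable β] [Primcodable σ] {f : α → List β}

theorem primrec_any {p : α × β → Bool} (hf : Primrec f) (hp : Primrec p) :
    Primrec fun a => (f a).any fun b => p (a, b) :=
  (Primrec.list_foldr (h := fun a z => p (a, z.1) || z.2) hf (Primrec.const false)
    (Primrec.or.comp (hp.comp (Primrec.pair .fst (Primrec.fst.comp .snd)))
      (Primrec.snd.comp .snd)).to₂).of_eq fun a => by
    induction f a with
    | nil => rfl
    | cons b l ih => simp [ih]

theorem primrec_all {p : α × β → Bool} (hf : Primrec f) (hp : Primrec p) :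
    Primrec fun a => (f a).all fun b => p (a, b) :=
  (Primrec.not.comp (primrec_any hf (Primrec.not.comp hp))).of_eq fun a => by
    rw [Bool.eq_iff_iff]
    simp

theorem primrec_flatMap {g : α × β → List σ} (hf : Primrec f) (hg : Primrec g) :
    Primrec fun a => (f a).flatMap fun b => g (a, b) :=
  Primrec.list_flatMap hf hg.to₂

theorem primrec_filter {p : α × β → Bool} (hf : Primrec f) (hp : Primrec p) :
    Primrec fun a => (f a).filter fun b => p (a, b) :=
  (primrec_flatMap (g := fun z => bif p z then [z.2] else []) hf
    (Primrec.cond hp (Primrec.list_cons.comp .snd (.const [])) (.const []))).of_eq fun a => by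
    induction f a with
    | nil => rfl
    | cons b l ih =>
      rw [List.flatMap_cons, ih, List.filter_cons]
      cases h : p (a, b) <;> simp

theorem primrec_countP {p : α × β → Bool} (hf : Primrec f) (hp : Primrec p) :
    Primrec fun a => (f a).countP fun b => p (a, b) :=
  (Primrec.list_length.comp (primrec_filter hf hp)).of_eq fun _ => List.countP_eq_length_filter.symm

theorem primrec_iterate {step : σ → σ} {n : α → ℕ} {g : α → σ} (hn : Primrec n) (hg : Primrec g)
    (hstep : Primrec step) : Primrec fun a => step^[n a] (g a) :=
  Primrec.nat_iterate hn hg (hstep.comp .snd).to₂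

end Primrec

section PrimrecWord

variable {α : Type*} [Primcodable α] {x e s t : α → Word} {i j k n : α → ℕ}

theorem primrec_select {a b c d : α → Word} (ha : Primrec a) (hb : Primrec b) (hc : Primrec c)
    (hd : Primrec d) : Primrec fun z => select (a z) (b z) (c z) (d z) :=
  (Primrec.cond (c := fun z => decide (a z = [])) (Primrec.eq.decide.comp ha (.const [])) hb
    (Primrec.cond (Primrec.list_headI.comp ha) hd hc)).of_eq fun z => by
    rcases a z with _ | ⟨_ | _, w⟩ <;> simp [select]

theorem primrec_dropSymbol : Primrec dropSymbol :=
  have h := Primrec.list_tail (α := Bool)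
  primrec_select .id .id .id (primrec_select h .id (h.comp h) (h.comp h))

theorem primrec_firstSymbol : Primrec firstSymbol :=
  primrec_select .id (.const []) (.const [])
    (primrec_select Primrec.list_tail (.const []) (.const [false]) (.const [true]))

theorem primrec_fieldHead : Primrec fieldHead :=
  primrec_flatMap (g := fun z => firstSymbol (dropSymbol^[z.2] z.1))
    (Primrec.list_range.comp Primrec.list_length)
    (primrec_firstSymbol.comp (primrec_iterate .snd .fst primrec_dropSymbol))

theorem primrec_fieldTail : Primrec fieldTail :=
  Primrec.list_tail.comp (primrec_iterate Primrec.list_length .id primrec_dropSymbol)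

theorem primrec_tri : Primrec tri :=
  (Primrec.nat_rec₁ (f := fun i m => m + i) 0 (Primrec.nat_add.comp .snd .fst)).of_eq fun n => by
    induction n with
    | zero => rfl
    | succ n ih => exact congrArg (· + n) ih

theorem primrec_field : Primrec field :=
  Primrec.list_append.comp (primrec_flatMap (g := fun z : Word × Bool => [true, z.2]) .id
    (Primrec.list_cons.comp (.const true) (Primrec.list_cons.comp .snd (.const [])))) (.const [false])

theorem primrec_sBits : Primrec sBits := primrec_fieldHead.comp primrec_fieldTail

theorem primrec_tBits : Primrec tBits :=
  primrec_fieldHead.comp (primrec_fieldTail.comp primrec_fieldTail)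

theorem primrec_pairWord (hx : Primrec x) (hi : Primrec i) :
    Primrec fun a => pairWord (x a) (i a) :=
  have h := primrec_fieldTail
  primrec_fieldHead.comp (primrec_iterate hi (h.comp (h.comp (h.comp hx))) h)

theorem primrec_isBits : Primrec isBits :=
  Primrec.not.comp (Primrec.eq.decide.comp (Primrec.list_drop.comp
    (Primrec.list_length.comp Primrec.list_tail) .id) (.const [false]))

theorem primrec_replicate : Primrec fun n : ℕ => List.replicate n true :=
  (Primrec.list_map Primrec.list_range (Primrec.const true).to₂).of_eq fun n => by simp

theorem primrec_isInstance : Primrec isInstance := by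
  have hrange : Primrec fun x => List.range (tri (sBits x).length) :=
    Primrec.list_range.comp (primrec_tri.comp (Primrec.list_length.comp primrec_sBits))
  have hpairs : Primrec fun x =>
      (List.range (tri (sBits x).length)).flatMap fun i => field (pairWord x i) :=
    primrec_flatMap (g := fun z => field (pairWord z.1 z.2)) hrange
      (primrec_field.comp (primrec_pairWord .fst .snd))
  have happ {a b : Word → Word} (ha : Primrec a) (hb : Primrec b) :
      Primrec fun x => field (a x) ++ b x := Primrec.list_append.comp (primrec_field.comp ha) hb
  have hlen {a : Word → Word} (ha : Primrec a) :
      Primrec fun x => List.replicate (a x).length true :=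
    primrec_replicate.comp (Primrec.list_length.comp ha)
  exact Primrec.and.comp (primrec_isBits.comp primrec_fieldHead) (Primrec.and.comp
    (Primrec.eq.decide.comp (hlen primrec_sBits) (hlen primrec_tBits))
    (Primrec.eq.decide.comp (happ primrec_fieldHead (happ primrec_sBits
      (happ primrec_tBits hpairs))) .id))

theorem primrec_bit (hs : Primrec s) (hi : Primrec i) :
    Primrec fun a => (s a).getD (i a) false :=
  (Primrec.list_getD false).comp hs hi

theorem primrec_edge (he : Primrec e) (hi : Primrec i) (hj : Primrec j) :
    Primrec fun a => edge (e a) (i a) (j a) :=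
  Primrec.cond (Primrec.nat_lt.decide.comp hi hj)
    (primrec_bit he (Primrec.nat_add.comp (primrec_tri.comp hj) hi))
    (Primrec.cond (Primrec.nat_lt.decide.comp hj hi)
      (primrec_bit he (Primrec.nat_add.comp (primrec_tri.comp hi) hj)) (.const false))

theorem primrec_isCoverWord (he : Primrec e) (hn : Primrec n) (hs : Primrec s) :
    Primrec fun a => isCoverWord (e a) (n a) (s a) :=
  have h1 : Primrec fun z : (α × ℕ) × ℕ => z.1.1 := Primrec.fst.comp .fst
  have h2 : Primrec fun z : (α × ℕ) × ℕ => z.1.2 := Primrec.snd.comp .fst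
  primrec_all (p := fun z : α × ℕ => (List.range (n z.1)).all fun j =>
      !edge (e z.1) z.2 j || ((s z.1).getD z.2 false || (s z.1).getD j false))
    (Primrec.list_range.comp hn)
    (primrec_all (p := fun z : (α × ℕ) × ℕ => !edge (e z.1.1) z.1.2 z.2 ||
        ((s z.1.1).getD z.1.2 false || (s z.1.1).getD z.2 false))
      (Primrec.list_range.comp (hn.comp .fst))
      (Primrec.or.comp (Primrec.not.comp (primrec_edge (he.comp h1) h2 .snd))
        (Primrec.or.comp (primrec_bit (hs.comp h1) h2) (primrec_bit (hs.comp h1) .snd))))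

theorem primrec_isMinCover (he : Primrec e) (hn : Primrec n) (hs : Primrec s) :
    Primrec fun a => isMinCover (e a) (n a) (s a) :=
  have h1 : Primrec fun z : (α × ℕ) × ℕ => z.1.1 := Primrec.fst.comp .fst
  have h2 : Primrec fun z : (α × ℕ) × ℕ => z.1.2 := Primrec.snd.comp .fst
  Primrec.and.comp (primrec_isCoverWord he hn hs)
    (primrec_all (p := fun z : α × ℕ => !(s z.1).getD z.2 false || (List.range (n z.1)).any fun j =>
        edge (e z.1) z.2 j && !(s z.1).getD j false) (Primrec.list_range.comp hn)
      (Primrec.or.comp (Primrec.not.comp (primrec_bit (hs.comp .fst) .snd))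
        (primrec_any (p := fun z : (α × ℕ) × ℕ =>
            edge (e z.1.1) z.1.2 z.2 && !(s z.1.1).getD z.2 false)
          (Primrec.list_range.comp (hn.comp .fst))
          (Primrec.and.comp (primrec_edge (he.comp h1) h2 .snd)
            (Primrec.not.comp (primrec_bit (hs.comp h1) .snd))))))

theorem primrec_sizeLE (hn : Primrec n) (hs : Primrec s) (hk : Primrec k) :
    Primrec fun a => sizeLE (n a) (s a) (k a) :=
  Primrec.nat_le.decide.comp (primrec_countP (p := fun z : α × ℕ => (s z.1).getD z.2 false)
    (Primrec.list_range.comp hn) (primrec_bit (hs.comp .fst) .snd)) hk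

theorem primrec_ofBits : Primrec ofBits :=
  (Primrec.list_foldr (h := fun _ z => bif z.1 then 2 * z.2 + 1 else 2 * z.2) .id (Primrec.const 0)
    (Primrec.cond (Primrec.fst.comp .snd) (Primrec.nat_double_succ.comp (Primrec.snd.comp .snd))
      (Primrec.nat_double.comp (Primrec.snd.comp .snd))).to₂).of_eq fun b => by
    unfold ofBits
    congr 1

end PrimrecWord

/-! ### Deciding satisfiability -/

/-- All words of length `n`. -/
def words (n : ℕ) : List Word :=
  (fun l : List Word => l.flatMap fun w => [false :: w, true :: w])^[n] [[]]

theorem mem_words {n : ℕ} {w : Word} : w ∈ words n ↔ w.length = n := by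
  induction n generalizing w with
  | zero => simp [words]
  | succ n ih =>
    rw [words, Function.iterate_succ_apply']
    simp only [List.mem_flatMap]
    constructor
    · rintro ⟨v, hv, hw⟩
      have := ih.1 hv
      simp only [List.mem_cons, List.not_mem_nil, or_false] at hw
      rcases hw with rfl | rfl <;> simp [this]
    · intro hw
      rcases w with _ | ⟨b, v⟩
      · simp at hw
      · refine ⟨v, ih.2 (by simpa using hw), ?_⟩
        cases b <;> simp

theorem primrec_words : Primrec words :=
  primrec_iterate .id (.const [[]]) (primrec_flatMap
    (g := fun z : List Word × Word => [false :: z.2, true :: z.2]) .id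
    (Primrec.list_cons.comp (Primrec.list_cons.comp (.const false) .snd)
      (Primrec.list_cons.comp (Primrec.list_cons.comp (.const true) .snd) (.const []))))

/-- The variables of a formula. -/
def vars (φ : CNF) : List Word := φ.flatMap fun c => c.flatMap fun l => [l.2]

/-- An assignment is a word `β` with one bit per occurrence of a variable; `idxOf` reads the bit of
the first occurrence, so repetitions in `vars φ` cause no conflict. -/
def isSatisfiable (φ : CNF) : Bool :=
  (words (vars φ).length).any fun β => φ.all fun c => c.any fun l =>
    β.getD ((vars φ).idxOf l.2) false == l.1

theorem isSatisfiable_iff (φ : CNF) : isSatisfiable φ = true ↔ Satisfiable φ := by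
  simp only [isSatisfiable, List.any_eq_true, List.all_eq_true, beq_iff_eq, mem_words]
  constructor
  · rintro ⟨β, -, h⟩
    exact ⟨fun v => β.getD ((vars φ).idxOf v) false, h⟩
  · rintro ⟨α, h⟩
    refine ⟨(vars φ).map α, by simp, fun c hc => ?_⟩
    obtain ⟨l, hl, hα⟩ := h c hc
    have hmem : l.2 ∈ vars φ := List.mem_flatMap.2 ⟨c, hc, List.mem_flatMap.2 ⟨l, hl, by simp⟩⟩
    refine ⟨l, hl, ?_⟩
    have hlt := List.idxOf_lt_length_of_mem hmem
    rw [← hα]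
    simp [hlt]

theorem primrec_vars : Primrec vars :=
  primrec_flatMap (g := fun z : CNF × List Literal => z.2.flatMap fun l : Literal => [l.2]) .id
    (primrec_flatMap (g := fun z : (CNF × List Literal) × Literal => [z.2.2]) .snd
      (Primrec.list_cons.comp (Primrec.snd.comp .snd) (.const [])))

theorem primrec_isSatisfiable : Primrec isSatisfiable :=
  primrec_any (p := fun z : CNF × Word => z.1.all fun c => c.any fun l =>
      z.2.getD ((vars z.1).idxOf l.2) false == l.1)
    (primrec_words.comp (Primrec.list_length.comp primrec_vars))
    (primrec_all (p := fun z : (CNF × Word) × List Literal => z.2.any fun l =>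
        z.1.2.getD ((vars z.1.1).idxOf l.2) false == l.1) .fst
      (primrec_any (p := fun z : ((CNF × Word) × List Literal) × Literal =>
          z.1.1.2.getD ((vars z.1.1.1).idxOf z.2.2) false == z.2.1) .snd
        (Primrec.beq.comp (primrec_bit (Primrec.snd.comp (Primrec.fst.comp .fst))
          ((Primrec.list_idxOf.comp (Primrec.snd.comp .snd)
            (primrec_vars.comp (Primrec.fst.comp (Primrec.fst.comp .fst)))).of_eq fun z => by
              congr 1
              exact lawful_beq_subsingleton _ _))
          (Primrec.fst.comp .snd))))

/-- The state of the parser of formulas: the complete clauses, the complete literals of the current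
clause, the data bits of the current literal, and, in the middle of a block, its first bit. -/
abbrev ParserState := (CNF × List Literal) × Word × Bool × Bool

def parseStep (σ : ParserState) (b : Bool) : ParserState :=
  bif σ.2.2.1 then
    bif σ.2.2.2 then
      bif b then ((σ.1.1 ++ [σ.1.2], []), [], false, false)
      else ((σ.1.1, σ.1.2 ++ [(σ.2.1.headI, σ.2.1.tail)]), [], false, false)
    else (σ.1, σ.2.1 ++ [b], false, false)
  else (σ.1, σ.2.1, true, b)

def parseCNF (w : Word) : CNF := (w.foldl parseStep (([], []), [], false, false)).1.1

theorem foldl_parseStep_data (p : CNF × List Literal) (l w : Word) :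
    (w.flatMap fun b => [false, b]).foldl parseStep (p, l, false, false) =
      (p, l ++ w, false, false) := by
  induction w generalizing l with
  | nil => simp
  | cons b w ih =>
    rw [List.flatMap_cons, List.foldl_append]
    exact (ih (l ++ [b])).trans (by simp)

theorem foldl_parseStep_literal (cs : CNF) (c : List Literal) (l : Literal) :
    (encodeLiteral l).foldl parseStep ((cs, c), [], false, false) =
      ((cs, c ++ [l]), [], false, false) := by
  rw [encodeLiteral, List.foldl_append, foldl_parseStep_data]
  rfl

theorem foldl_parseStep_clause (cs : CNF) (c : List Literal) :
    (encodeClause c).foldl parseStep ((cs, []), [], false, false) =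
      ((cs ++ [c], []), [], false, false) := by
  have : ∀ c₀, (c.flatMap encodeLiteral).foldl parseStep ((cs, c₀), [], false, false) =
      ((cs, c₀ ++ c), [], false, false) := by
    induction c with
    | nil => simp
    | cons l c ih =>
      intro c₀
      rw [List.flatMap_cons, List.foldl_append, foldl_parseStep_literal, ih]
      simp
  rw [encodeClause, List.foldl_append, this]
  rfl

theorem parseCNF_encodeCNF (φ : CNF) : parseCNF (encodeCNF φ) = φ := by
  have : ∀ cs, (encodeCNF φ).foldl parseStep ((cs, []), [], false, false) =
      ((cs ++ φ, []), [], false, false) := by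
    induction φ with
    | nil => simp [encodeCNF]
    | cons c φ ih =>
      intro cs
      rw [encodeCNF, List.flatMap_cons, List.foldl_append, foldl_parseStep_clause, ← encodeCNF, ih]
      simp
  rw [parseCNF, this]
  rfl

/-- The parser returns some formula for every word, even a malformed one; encoding the result again
detects whether the word was an encoding. -/
theorem mem_SAT_iff (w : Word) :
    w ∈ SAT ↔ encodeCNF (parseCNF w) = w ∧ Satisfiable (parseCNF w) := by
  constructor
  · rintro ⟨φ, rfl, h⟩
    rw [parseCNF_encodeCNF]
    exact ⟨rfl, h⟩
  · exact fun h => ⟨_, h⟩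

theorem primrec_parseStep : Primrec₂ parseStep := by
  have h1 : Primrec fun z : ParserState × Bool => z.1.1 := Primrec.fst.comp .fst
  have h2 : Primrec fun z : ParserState × Bool => z.1.2 := Primrec.snd.comp .fst
  have hw : Primrec fun z : ParserState × Bool => z.1.2.1 := Primrec.fst.comp h2
  have hp := Primrec.snd.comp h2
  have hcs := Primrec.fst.comp h1
  have hc := Primrec.snd.comp h1
  have hsing {σ : Type} [Primcodable σ] {g : ParserState × Bool → σ} (hg : Primrec g) :
      Primrec fun z => [g z] := Primrec.list_cons.comp hg (.const [])
  have hend : Primrec fun _ : ParserState × Bool => (([] : Word), false, false) := .const _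
  exact Primrec.cond (Primrec.fst.comp hp)
    (Primrec.cond (Primrec.snd.comp hp)
      (Primrec.cond .snd
        (.pair (.pair (Primrec.list_append.comp hcs (hsing hc)) (.const [])) hend)
        (.pair (.pair hcs (Primrec.list_append.comp hc (hsing (.pair
          (Primrec.list_headI.comp hw) (Primrec.list_tail.comp hw))))) hend))
      (.pair h1 (.pair (Primrec.list_append.comp hw (hsing .snd)) (.const (false, false)))))
    (.pair h1 (.pair hw (.pair (.const true) .snd)))

theorem primrec_parseCNF : Primrec parseCNF :=
  Primrec.fst.comp (Primrec.fst.comp (Primrec.list_foldl .id (Primrec.const _)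
    (primrec_parseStep.comp (Primrec.fst.comp .snd) (Primrec.snd.comp .snd)).to₂))

theorem primrec_encodeCNF : Primrec encodeCNF := by
  have hlit : Primrec encodeLiteral :=
    Primrec.list_append.comp (primrec_flatMap (g := fun z : Literal × Bool => [false, z.2])
      (Primrec.list_cons.comp .fst .snd) (Primrec.list_cons.comp (.const false)
        (Primrec.list_cons.comp .snd (.const [])))) (.const [true, false])
  have hclause : Primrec encodeClause :=
    Primrec.list_append.comp (primrec_flatMap
      (g := fun z : List Literal × Literal => encodeLiteral z.2) .id (hlit.comp .snd))
      (.const [true, true])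
  exact primrec_flatMap (g := fun z : CNF × List Literal => encodeClause z.2) .id (hclause.comp .snd)

open Classical in
theorem primrec_mem_SAT : Primrec fun w : Word => decide (w ∈ SAT) :=
  (Primrec.and.comp (Primrec.eq.decide.comp (primrec_encodeCNF.comp primrec_parseCNF) .id)
    (primrec_isSatisfiable.comp primrec_parseCNF)).of_eq fun w => by
    rw [Bool.eq_iff_iff]
    simp [mem_SAT_iff, isSatisfiable_iff]

theorem primrec_edgeBits : Primrec edgeBits := by
  classical
  exact primrec_flatMap (g := fun z => [decide (pairWord z.1 z.2 ∈ SAT)])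
    (Primrec.list_range.comp (primrec_tri.comp (Primrec.list_length.comp primrec_sBits)))
    (Primrec.list_cons.comp (primrec_mem_SAT.comp (primrec_pairWord .fst .snd)) (.const []))

/-! ### Deciding reconfigurability -/

/-- The set `D` may follow the set `C` in a reconfiguration sequence. -/
def isStep (e : Word) (n k : ℕ) (C D : Word) : Bool :=
  isCoverWord e n D && (sizeLE n D k &&
    decide ((List.range n).countP (fun i => !(C.getD i false == D.getD i false)) ≤ 1))

/-- The sets that are reached from `s` by sequences with `m` steps. -/
def reach (e : Word) (n k : ℕ) (s : Word) (m : ℕ) : List Word :=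
  m.rec [s] fun _ l => (words n).filter fun D => l.any fun C => isStep e n k C D

/-- A sequence of `len` sets has `len - 1` steps. The start is tested separately because `isStep`
checks only the set it moves to. -/
def isReconfigurable (e : Word) (n k : ℕ) (s t : Word) (len : ℕ) : Bool :=
  decide (1 ≤ len) && (isCoverWord e n s && (sizeLE n s k &&
    (reach e n k s (len - 1)).any fun D => decide (D = t)))

section PrimrecReach

variable {α : Type*} [Primcodable α] {e s t : α → Word} {k n m : α → ℕ}

theorem primrec_isStep (he : Primrec e) (hn : Primrec n) (hk : Primrec k) (hs : Primrec s)
    (ht : Primrec t) : Primrec fun a => isStep (e a) (n a) (k a) (s a) (t a) :=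
  Primrec.and.comp (primrec_isCoverWord he hn ht) (Primrec.and.comp (primrec_sizeLE hn ht hk)
    (Primrec.nat_le.decide.comp (primrec_countP
      (p := fun z : α × ℕ => !((s z.1).getD z.2 false == (t z.1).getD z.2 false))
      (Primrec.list_range.comp hn) (Primrec.not.comp (Primrec.beq.comp
        (primrec_bit (hs.comp .fst) .snd) (primrec_bit (ht.comp .fst) .snd)))) (.const 1)))

theorem primrec_reach (he : Primrec e) (hn : Primrec n) (hk : Primrec k) (hs : Primrec s)
    (hm : Primrec m) : Primrec fun a => reach (e a) (n a) (k a) (s a) (m a) := by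
  have h1 : Primrec fun z : ((α × (ℕ × List Word)) × Word) × Word => z.1.1.1 :=
    Primrec.fst.comp (Primrec.fst.comp .fst)
  exact Primrec.nat_rec' hm (Primrec.list_cons.comp hs (.const []))
    (Primrec.to₂ (primrec_filter (p := fun z : (α × (ℕ × List Word)) × Word =>
        z.1.2.2.any fun C => isStep (e z.1.1) (n z.1.1) (k z.1.1) C z.2)
      (primrec_words.comp (hn.comp .fst))
      (primrec_any (p := fun z : ((α × (ℕ × List Word)) × Word) × Word =>
          isStep (e z.1.1.1) (n z.1.1.1) (k z.1.1.1) z.2 z.1.2)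
        (Primrec.snd.comp (Primrec.snd.comp .fst))
        (primrec_isStep (he.comp h1) (hn.comp h1) (hk.comp h1) .snd (Primrec.snd.comp .fst)))))

theorem primrec_isReconfigurable (he : Primrec e) (hn : Primrec n) (hk : Primrec k)
    (hs : Primrec s) (ht : Primrec t) (hm : Primrec m) :
    Primrec fun a => isReconfigurable (e a) (n a) (k a) (s a) (t a) (m a) :=
  Primrec.and.comp (Primrec.nat_le.decide.comp (.const 1) hm)
    (Primrec.and.comp (primrec_isCoverWord he hn hs) (Primrec.and.comp (primrec_sizeLE hn hs hk)
      (primrec_any (p := fun z : α × Word => decide (z.2 = t z.1))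
        (primrec_reach he hn hk hs (Primrec.nat_sub.comp hm (.const 1)))
        (Primrec.eq.decide.comp .snd (ht.comp .fst)))))

end PrimrecReach

theorem getD_charVector {n : ℕ} (C : Finset (Fin n)) (i : Fin n) :
    (charVector C).getD i false = decide (i ∈ C) := by
  simp [charVector]

theorem mem_iff_getD_charVector {n : ℕ} (C : Finset (Fin n)) (i : Fin n) :
    i ∈ C ↔ (charVector C).getD i false = true := by
  rw [getD_charVector, decide_eq_true_iff]

theorem charVector_injective {n : ℕ} : Function.Injective (charVector (n := n)) := by
  intro C D h
  ext i
  rw [mem_iff_getD_charVector, mem_iff_getD_charVector, h]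

theorem length_charVector {n : ℕ} (C : Finset (Fin n)) : (charVector C).length = n := by
  simp [charVector]

theorem exists_charVector_eq {n : ℕ} {w : Word} (hw : w.length = n) :
    ∃ C : Finset (Fin n), charVector C = w := by
  subst hw
  exact ⟨_, (charVector_filter w.length fun i => w.getD i false).trans (map_getD_range w)⟩

section Reach

variable {A : Instance} {e : Word} {k : ℕ}

theorem isStep_iff (hadj : ∀ i j, A.graph.Adj i j ↔ edge e i j = true) (C D : Finset (Fin A.n)) :
    isStep e A.n k (charVector C) (charVector D) = true ↔
      (A.IsCover D ∧ D.card ≤ k) ∧ (symmDiff C D).card ≤ 1 := by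
  have hsymm : (symmDiff C D).card = (List.range A.n).countP fun i =>
      !((charVector C).getD i false == (charVector D).getD i false) := by
    have hs : (List.range A.n).map
        (fun i => !((charVector C).getD i false == (charVector D).getD i false)) =
        charVector (symmDiff C D) := by
      rw [charVector, ← List.map_coe_finRange_eq_range, List.map_map]
      refine List.map_congr_left fun i _ => ?_
      simp only [Function.comp_apply, getD_charVector, Finset.mem_symmDiff]
      by_cases h : i ∈ C <;> by_cases h' : i ∈ D <;> simp [h, h']
    rw [card_eq_countP (mem_iff_getD_charVector _), ← hs]
    refine List.countP_congr fun i hi => ?_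
    rw [List.mem_range] at hi
    simp [hi]
  simp only [isStep, Bool.and_eq_true, isCoverWord_iff hadj (mem_iff_getD_charVector D), sizeLE,
    ← card_eq_countP (mem_iff_getD_charVector D), decide_eq_true_eq, hsymm, and_assoc]

/-- By induction on the number of steps, splitting off the last set; every word produced by `reach`
has length `A.n` and hence is a characteristic vector. -/
theorem mem_reach_iff (hadj : ∀ i j, A.graph.Adj i j ↔ edge e i j = true) {S : Finset (Fin A.n)}
    (hS : A.IsCover S ∧ S.card ≤ k) (m : ℕ) (D : Finset (Fin A.n)) :
    charVector D ∈ reach e A.n k (charVector S) m ↔ ∃ X : ℕ → Finset (Fin A.n),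
      X 1 = S ∧ X (m + 1) = D ∧ (∀ i, 1 ≤ i → i ≤ m + 1 → A.IsCover (X i) ∧ (X i).card ≤ k) ∧
        ∀ i, 1 ≤ i → i < m + 1 → (symmDiff (X i) (X (i + 1))).card ≤ 1 := by
  induction m generalizing D with
  | zero =>
    change charVector D ∈ [charVector S] ↔ _
    rw [List.mem_singleton, charVector_injective.eq_iff, zero_add]
    constructor
    · rintro rfl
      exact ⟨fun _ => D, rfl, rfl, fun _ _ _ => hS, by omega⟩
    · rintro ⟨X, rfl, rfl, -⟩
      rfl
  | succ m ih =>
    have hmem : charVector D ∈ reach e A.n k (charVector S) (m + 1) ↔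
        ∃ C : Finset (Fin A.n), charVector C ∈ reach e A.n k (charVector S) m ∧
          isStep e A.n k (charVector C) (charVector D) = true := by
      change charVector D ∈ (words A.n).filter (fun D =>
        (reach e A.n k (charVector S) m).any fun C => isStep e A.n k C D) ↔ _
      rw [List.mem_filter, mem_words, List.any_eq_true]
      constructor
      · rintro ⟨-, w, hw, h⟩
        have hlen : w.length = A.n := by
          cases m with
          | zero =>
            rw [List.mem_singleton.1 hw]
            exact length_charVector S
          | succ m => exact mem_words.1 (List.mem_filter.1 hw).1
        obtain ⟨C, rfl⟩ := exists_charVector_eq hlen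
        exact ⟨C, hw, h⟩
      · rintro ⟨C, hC, h⟩
        exact ⟨length_charVector D, _, hC, h⟩
    rw [hmem]
    simp only [ih, isStep_iff hadj]
    constructor
    · rintro ⟨C, ⟨X, hX1, hXC, hX, hstep⟩, hD, hCD⟩
      refine ⟨fun i => if i ≤ m + 1 then X i else D, by simp [hX1], by simp, fun i h1 h2 => ?_,
        fun i h1 h2 => ?_⟩
      · by_cases h : i ≤ m + 1
        · simpa [h] using hX i h1 h
        · simpa [h] using hD
      · by_cases h : i < m + 1
        · simpa [h.le, Nat.lt_succ_iff.1 h] using hstep i h1 h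
        · obtain rfl : i = m + 1 := by omega
          simpa [hXC] using hCD
    · rintro ⟨X, hX1, rfl, hX, hstep⟩
      exact ⟨X (m + 1), ⟨X, hX1, rfl, fun i h1 h2 => hX i h1 (by omega),
        fun i h1 h2 => hstep i h1 (by omega)⟩, hX _ (by omega) le_rfl, hstep _ (by omega) (by omega)⟩

theorem isReconfigurable_iff (hadj : ∀ i j, A.graph.Adj i j ↔ edge e i j = true) :
    isReconfigurable e A.n k (charVector A.S) (charVector A.T) A.len = true ↔
      A.Reconfigurable k := by
  simp only [isReconfigurable, Bool.and_eq_true, decide_eq_true_eq, List.any_eq_true,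
    exists_eq_right, isCoverWord_iff hadj (mem_iff_getD_charVector A.S), sizeLE,
    ← card_eq_countP (mem_iff_getD_charVector A.S)]
  refine and_congr_right fun hlen => ?_
  constructor
  · rintro ⟨h1, h2, h⟩
    rw [mem_reach_iff hadj ⟨h1, h2⟩, Nat.sub_add_cancel hlen] at h
    exact h
  · rintro ⟨X, h1, h2, hX, hstep⟩
    have hS : A.IsCover A.S ∧ A.S.card ≤ k := h1 ▸ hX 1 le_rfl hlen
    refine ⟨hS.1, hS.2, ?_⟩
    rw [mem_reach_iff hadj hS, Nat.sub_add_cancel hlen]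
    exact ⟨X, h1, h2, hX, hstep⟩

end Reach

/-! ### Decidability -/

def IsYesInstance (x : Word) (k : ℕ) : Prop :=
  isInstance x = true ∧ isMinCover (edgeBits x) (sBits x).length (sBits x) = true ∧
    isMinCover (edgeBits x) (sBits x).length (tBits x) = true ∧
    isReconfigurable (edgeBits x) (sBits x).length k (sBits x) (tBits x) (ofBits (lenBits x)) = true

theorem IsYesInstance_iff (x : Word) (k : ℕ) :
    IsYesInstance x k ↔ (x, k) ∈ DiscoveryVertexCoverReconfiguration := by
  rw [mem_discoveryVertexCoverReconfiguration_iff, IsYesInstance]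
  refine and_congr_right fun hx => ?_
  have hS : sBits x = charVector (instanceOf x).S :=
    (map_getD_range _).symm.trans (charVector_filter _ _).symm
  have hT : tBits x = charVector (instanceOf x).T := by
    simp only [isInstance, Bool.and_eq_true, decide_eq_true_eq, List.replicate_inj] at hx
    have h := map_getD_range (tBits x)
    rw [← hx.2.1.1] at h
    exact h.symm.trans (charVector_filter _ _).symm
  rw [← isReconfigurable_iff (adj_instanceOf x), Instance.IsProper,
    ← isMinCover_iff (adj_instanceOf x) mem_S_instanceOf,
    ← isMinCover_iff (adj_instanceOf x) mem_T_instanceOf, and_assoc, ← hS, ← hT]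
  rfl

theorem computablePred_discoveryVertexCoverReconfiguration :
    ComputablePred (fun z : Word × ℕ => z ∈ DiscoveryVertexCoverReconfiguration) := by
  have he : Primrec fun z : Word × ℕ => edgeBits z.1 := primrec_edgeBits.comp .fst
  have hs : Primrec fun z : Word × ℕ => sBits z.1 := primrec_sBits.comp .fst
  have ht : Primrec fun z : Word × ℕ => tBits z.1 := primrec_tBits.comp .fst
  have hn : Primrec fun z : Word × ℕ => (sBits z.1).length := Primrec.list_length.comp hs
  have hm : Primrec fun z : Word × ℕ => ofBits (lenBits z.1) :=
    primrec_ofBits.comp (primrec_fieldHead.comp .fst)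
  have h := Primrec.and.comp (primrec_isInstance.comp .fst)
    (Primrec.and.comp (primrec_isMinCover he hn hs) (Primrec.and.comp (primrec_isMinCover he hn ht)
      (primrec_isReconfigurable he hn .snd hs ht hm)))
  classical
  refine ⟨inferInstance, (h.of_eq fun z => ?_).to_comp⟩
  rw [Bool.eq_iff_iff, decide_eq_true_iff]
  refine Iff.trans ?_ (IsYesInstance_iff z.1 z.2)
  simp only [IsYesInstance, Bool.and_eq_true]

end OracleKernel
-- The kernelization theorem.
theorem theorem7p2 :
    OracleKernel.HasPolyPNPKernel OracleKernel.DiscoveryVertexCoverReconfiguration :=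
  ⟨OracleKernel.computablePred_discoveryVertexCoverReconfiguration,
    fun z => (OracleKernel.kernel z.1 z.2, z.2), OracleKernel.polyTimeComputable_kernel,
    OracleKernel.exists_polynomial_kernel_le, fun z => OracleKernel.kernel_mem_iff z.1 z.2⟩
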